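/- **Setting.** Let $0<d<1<u$ and $\bar g>0$, let $\varphi:\mathbb R\to\mathbb R$, and let $\xi_0,\xi_1,\xi_2,\dots$, $x_0$, $\gamma_0$, $\gamma_1$ be real random variables on a probability space with $0<\gamma_0\le\bar g$ and $0<\gamma_1\le\bar g$. Let the process $\{x_t,\gamma_t\}$ be given by $$x_t=x_{t-1}-\gamma_{t-1}y_t,\qquad y_t=\varphi(x_{t-1})+\xi_t\qquad(t\ge 1),$$ $$\gamma_t=\begin{cases}\min\{u\,\gamma_{t-1},\bar g\}&\text{if } y_{t-1}y_t>0,\\ d\,\gamma_{t-1}&\text{if } y_{t-1}y_t\le 0,\end{cases}\qquad(t\ge 2).$$ **Assumptions.** - A1. For every $t\ge 0$, $\xi_{t+1}$ is independent of the $\sigma$-algebra $\mathcal F_t$ generated by $x_i,\gamma_i,\xi_i$, $0\le i\le t$. - A2. The $\xi_t$, $t\ge 1$, are identically distributed with $\mathrm E\,\xi_t=0$ and $S:=\mathrm{Var}\,\xi_t<\infty$. - A3. (a) There is $L>0$ such that $\mathrm P(\xi_1\in I)>0$ for every nondegenerate interval $I\subset[-L,L]$; (b) $\mathrm P(\xi_1=0)=0$.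 - A4. $\varphi\in C^1(\mathbb R)$ and $M:=\sup_x|\varphi'(x)|<\infty$. - A5. $\bar g<2/M$. - A6. There is $R>0$ such that (a) $x\varphi(x)>0$ whenever $|x|\ge R$, and (b) $\inf_{|x|\ge R}\varphi^2(x)>\dfrac{\bar g M S}{2-\bar g M}$. **Notation.** For $z\in\mathbb R$ put $$k_+(z)=\lim_{\epsilon\to0^+}\sup\{\mathrm P((a+\xi_1)(b+\xi_2)>0): a,b\in\mathbb R,\ |a-z|<\epsilon,\ |b-z|<\epsilon\},$$ $$k_-(z)=\lim_{\epsilon\to0^+}\inf\{\mathrm P((a+\xi_1)(b+\xi_2)>0): a,b\in\mathbb R,\ |a-z|<\epsilon,\ |b-z|<\epsilon\},$$ and let $$\mathrm k=\frac{\ln(1/d)}{\ln(u/d)},\qquad V_-^{[\mathrm k]}=\{x\in\mathbb R: k_-(\varphi(x))\le \mathrm k\}.$$ **Theorem.** Under A1–A6: (a) If $\mathrm k>k_+(0)$, then almost surely $\{x_t\}$ converges to a point of $V_-^{[\mathrm k]}$. (b) If $\mathrm k<\inf_{z\in\mathbb R}k_-(z)$, then almost surely $\{x_t\}$ diverges,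 that is, it does not converge to any real number. -/

import Mathlib

open MeasureTheory ProbabilityTheory Filter Topology Set

namespace StochApprox

/-- The measured value `y_t = φ(x_{t-1}) + ξ_t`, for `t ≥ 1` (the value at `t = 0` is never used). -/
def obs {Ω : Type*} (φ : ℝ → ℝ) (ξ x : ℕ → Ω → ℝ) (t : ℕ) (ω : Ω) : ℝ :=
  φ (x (t - 1) ω) + ξ t ω

/-- `(x_t, γ_t)` is produced by the algorithm with multiplicatively adapted step size, with
parameters `u`, `d`, step bound `gbar`, measured function `φ` and measurement errors `ξ`. The
initial values `x_0`, `γ_0`, `γ_1` are random variables. -/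
structure IsProcess {Ω : Type*} [MeasurableSpace Ω] (u d gbar : ℝ) (φ : ℝ → ℝ)
    (ξ x γ : ℕ → Ω → ℝ) : Prop where
  measurable_x_zero : Measurable (x 0)
  measurable_γ_zero : Measurable (γ 0)
  measurable_γ_one : Measurable (γ 1)
  γ_zero_mem : ∀ ω, γ 0 ω ∈ Ioc 0 gbar
  γ_one_mem : ∀ ω, γ 1 ω ∈ Ioc 0 gbar
  x_step : ∀ t, 1 ≤ t → ∀ ω, x t ω = x (t - 1) ω - γ (t - 1) ω * obs φ ξ x t ω
  γ_step : ∀ t, 2 ≤ t → ∀ ω, γ t ω =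
    if 0 < obs φ ξ x (t - 1) ω * obs φ ξ x t ω then min (u * γ (t - 1) ω) gbar
    else d * γ (t - 1) ω

/-- The σ-algebra `F_t` generated by `x_i`, `γ_i`, `ξ_i`, `0 ≤ i ≤ t`. -/
def history {Ω : Type*} (ξ x γ : ℕ → Ω → ℝ) (t : ℕ) : MeasurableSpace Ω :=
  ⨆ i ∈ Finset.range (t + 1),
    (MeasurableSpace.comap (x i) inferInstance ⊔ MeasurableSpace.comap (γ i) inferInstance ⊔
      MeasurableSpace.comap (ξ i) inferInstance)

/-- Assumption A1: `ξ_{t+1}` is independent of `F_t`. -/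
def A1 {Ω : Type*} [MeasurableSpace Ω] (μ : Measure Ω) (ξ x γ : ℕ → Ω → ℝ) : Prop :=
  ∀ t, Indep (MeasurableSpace.comap (ξ (t + 1)) inferInstance) (history ξ x γ t) μ

/-- Assumption A2: the errors `ξ_t`, `t ≥ 1`, are identically distributed with zero mean and
finite variance. -/
def A2 {Ω : Type*} [MeasurableSpace Ω] (μ : Measure Ω) (ξ : ℕ → Ω → ℝ) : Prop :=
  (∀ t, 1 ≤ t → IdentDistrib (ξ t) (ξ 1) μ μ) ∧ MemLp (ξ 1) 2 μ ∧ ∫ ω, ξ 1 ω ∂μ = 0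

/-- Assumption A3: (a) `ξ_1` charges every (nondegenerate) interval contained in some `[-L, L]`;
(b) `ξ_1` has no atom at `0`. -/
def A3 {Ω : Type*} [MeasurableSpace Ω] (μ : Measure Ω) (ξ : ℕ → Ω → ℝ) : Prop :=
  (∃ L : ℝ, 0 < L ∧ ∀ I : Set ℝ, I.OrdConnected → I.Nontrivial → I ⊆ Icc (-L) L →
    0 < μ {ω | ξ 1 ω ∈ I}) ∧ μ {ω | ξ 1 ω = 0} = 0

/-- Assumption A4: `φ` is continuously differentiable with bounded derivative. -/
def A4 (φ : ℝ → ℝ) : Prop :=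
  ContDiff ℝ 1 φ ∧ BddAbove (range fun x => |deriv φ x|)

/-- `M = sup_x |φ'(x)|`. -/
noncomputable def derivBound (φ : ℝ → ℝ) : ℝ := ⨆ x, |deriv φ x|

/-- Assumption A5. -/
def A5 (φ : ℝ → ℝ) (gbar : ℝ) : Prop := gbar < 2 / derivBound φ

/-- Assumption A6, where `S = Var ξ_1`. -/
def A6 {Ω : Type*} [MeasurableSpace Ω] (μ : Measure Ω) (ξ : ℕ → Ω → ℝ) (φ : ℝ → ℝ)
    (gbar : ℝ) : Prop :=
  ∃ R : ℝ, 0 < R ∧ (∀ x, R ≤ |x| → 0 < x * φ x) ∧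
    gbar * derivBound φ * variance (ξ 1) μ / (2 - gbar * derivBound φ) <
      sInf ((fun x => φ x ^ 2) '' {x | R ≤ |x|})

/-- The set of the numbers `P((a + ξ_1)(b + ξ_2) > 0)`, where `|a - z| < ε` and `|b - z| < ε`. -/
def agreeSet {Ω : Type*} [MeasurableSpace Ω] (μ : Measure Ω) (ξ : ℕ → Ω → ℝ) (z ε : ℝ) : Set ℝ :=
  {r | ∃ a b : ℝ, |a - z| < ε ∧ |b - z| < ε ∧ r = μ.real {ω | 0 < (a + ξ 1 ω) * (b + ξ 2 ω)}}

/-- `k_+(z)`, a limit of suprema as `ε → 0+`. -/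
noncomputable def kPlus {Ω : Type*} [MeasurableSpace Ω] (μ : Measure Ω) (ξ : ℕ → Ω → ℝ)
    (z : ℝ) : ℝ :=
  limUnder (𝓝[>] (0 : ℝ)) fun ε => sSup (agreeSet μ ξ z ε)

/-- `k_-(z)`, a limit of infima as `ε → 0+`. -/
noncomputable def kMinus {Ω : Type*} [MeasurableSpace Ω] (μ : Measure Ω) (ξ : ℕ → Ω → ℝ)
    (z : ℝ) : ℝ :=
  limUnder (𝓝[>] (0 : ℝ)) fun ε => sInf (agreeSet μ ξ z ε)

theorem agreeSet_subset_Icc {Ω : Type*} [MeasurableSpace Ω] (μ : Measure Ω)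
    [IsProbabilityMeasure μ] (ξ : ℕ → Ω → ℝ) (z ε : ℝ) : agreeSet μ ξ z ε ⊆ Icc 0 1 := by
  rintro r ⟨a, b, -, -, rfl⟩
  exact ⟨measureReal_nonneg, measureReal_le_one⟩

theorem agreeSet_mono {Ω : Type*} [MeasurableSpace Ω] (μ : Measure Ω) (ξ : ℕ → Ω → ℝ)
    (z : ℝ) {ε ε' : ℝ} (h : ε ≤ ε') : agreeSet μ ξ z ε ⊆ agreeSet μ ξ z ε' := by
  rintro r ⟨a, b, ha, hb, rfl⟩
  exact ⟨a, b, ha.trans_le h, hb.trans_le h, rfl⟩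

theorem agreeSet_nonempty {Ω : Type*} [MeasurableSpace Ω] (μ : Measure Ω) (ξ : ℕ → Ω → ℝ)
    (z : ℝ) {ε : ℝ} (h : 0 < ε) : (agreeSet μ ξ z ε).Nonempty :=
  ⟨_, z, z, by simpa using h, by simpa using h, rfl⟩

/-- The limit that defines `k_+(z)` exists. -/
theorem tendsto_kPlus {Ω : Type*} [MeasurableSpace Ω] (μ : Measure Ω) [IsProbabilityMeasure μ]
    (ξ : ℕ → Ω → ℝ) (z : ℝ) :
    Tendsto (fun ε => sSup (agreeSet μ ξ z ε)) (𝓝[>] (0 : ℝ)) (𝓝 (kPlus μ ξ z)) := by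
  refine tendsto_nhds_limUnder ⟨_, MonotoneOn.tendsto_nhdsGT (α := ℝ) (x := 0) ?_ ?_⟩
  · intro ε hε ε' _ h
    exact csSup_le_csSup (bddAbove_Icc.mono (agreeSet_subset_Icc μ ξ z ε'))
      (agreeSet_nonempty μ ξ z hε) (agreeSet_mono μ ξ z h)
  · refine ⟨0, ?_⟩
    rintro _ ⟨ε, -, rfl⟩
    exact Real.sSup_nonneg fun r hr => (agreeSet_subset_Icc μ ξ z ε hr).1

/-- The limit that defines `k_-(z)` exists. -/
theorem tendsto_kMinus {Ω : Type*} [MeasurableSpace Ω] (μ : Measure Ω) [IsProbabilityMeasure μ]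
    (ξ : ℕ → Ω → ℝ) (z : ℝ) :
    Tendsto (fun ε => sInf (agreeSet μ ξ z ε)) (𝓝[>] (0 : ℝ)) (𝓝 (kMinus μ ξ z)) := by
  refine tendsto_nhds_limUnder ⟨_, AntitoneOn.tendsto_nhdsGT (α := ℝ) (x := 0) ?_ ?_⟩
  · intro ε hε ε' _ h
    exact csInf_le_csInf (bddBelow_Icc.mono (agreeSet_subset_Icc μ ξ z ε'))
      (agreeSet_nonempty μ ξ z hε) (agreeSet_mono μ ξ z h)
  · refine ⟨1, ?_⟩
    rintro _ ⟨ε, hε, rfl⟩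
    obtain ⟨r, hr⟩ := agreeSet_nonempty μ ξ z hε
    exact (csInf_le (bddBelow_Icc.mono (agreeSet_subset_Icc μ ξ z ε)) hr).trans
      (agreeSet_subset_Icc μ ξ z ε hr).2

/-- `V_-^{[a]} = {x : k_-(φ(x)) ≤ a}`. -/
def VMinusClosed {Ω : Type*} [MeasurableSpace Ω] (μ : Measure Ω) (ξ : ℕ → Ω → ℝ) (φ : ℝ → ℝ)
    (a : ℝ) : Set ℝ :=
  {x | kMinus μ ξ (φ x) ≤ a}

/-- The critical ratio `ln(1/d) / ln(u/d)`. -/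
noncomputable def critRatio (u d : ℝ) : ℝ := Real.log (1 / d) / Real.log (u / d)

end StochApprox

/-! A sign agreement adds at most ln u to ln γ and a disagreement adds ln d. The mean increment
therefore changes sign where agreements have probability `critRatio u d`. Consecutive observations
near x agree in sign with probability about P(ξ > -w)² + P(ξ < -w)², w = φ(x). This number decides
whether steps shrink or grow there, and `kMinus` and `kPlus` enter only as bounds for it from below
and above.

Summable steps. If the number at w = 0 is subcritical, then γ^θ, weighted by the last sign,
contracts in the mean while |φ(x)| is small. So from a small step and a small |φ(x)| the steps are
summable with probability at least 1/2 (`exists_leadsTo_of_contraction`). Favourable errors lead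
there, with probability bounded below, from any state with bounded x and γ ≥ γ₀:
`exists_leadsTo_of_bounded` makes |φ(x)| small, `exists_leadsTo_of_small_value` then makes γ small.
Outside these two kinds of states a primitive Φ of φ decreases in the mean by at least δγ, so they
recur unless Σγ < ∞ (`ae_frequently_mem`). Lévy's 0-1 law (`LeadsTo.ae_mem`) turns a bounded-below
probability at recurrent states into certainty. Summable steps make x converge, by a discrete
Gronwall estimate (`ae_exists_tendsto_of_summableSteps`).

Impossible limits. Where the number is supercritical, a weighted γ^(-θ) contracts in the mean. The
cap on γ interferes only for γ ≥ ḡ/u, and there the noise moves x by a fixed amount with probability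
at least κ, which convergence forbids eventually. As γ^(-θ) is bounded below, staying near such a
point forever has probability zero (`ae_not_forall_mem_Icc`). Hence every limit lies in V_-^[k].
This completes (a), and it is all of (b), where V_-^[k] is empty. -/

namespace StochApprox

open scoped ENNReal

/-! ### Recursions driven by independent noise, and a 0-1 law for recurrent states. -/

/-- `X` is driven by the recursion `X (n + 1) = F (X n) (E n)`, where the noise `E n` has law `ν`
and is independent of the past `ℱ n`. -/
structure NoiseDriven {Ω S : Type*} {mΩ : MeasurableSpace Ω} [MeasurableSpace S] (μ : Measure Ω)
    (ν : Measure ℝ) (F : S → ℝ → S) (ℱ : Filtration ℕ mΩ) (X : ℕ → Ω → S) (E : ℕ → Ω → ℝ) :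
    Prop where
  measurable_map : Measurable (Function.uncurry F)
  adapted : ∀ n, Measurable[ℱ n] (X n)
  measurable_noise : ∀ n, Measurable (E n)
  map_noise : ∀ n, μ.map (E n) = ν
  indep : ∀ n, Indep (MeasurableSpace.comap (E n) inferInstance) (ℱ n) μ
  succ : ∀ n ω, X (n + 1) ω = F (X n ω) (E n ω)

section Chain

variable {Ω S : Type*} {mΩ : MeasurableSpace Ω} [MeasurableSpace S] {μ : Measure Ω}
  [IsProbabilityMeasure μ] {ν : Measure ℝ} {F : S → ℝ → S} {ℱ : Filtration ℕ mΩ}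
  {X : ℕ → Ω → S} {E : ℕ → Ω → ℝ}

theorem NoiseDriven.isProbabilityMeasure (h : NoiseDriven μ ν F ℱ X E) :
    IsProbabilityMeasure ν := by
  rw [← h.map_noise 0]
  exact Measure.isProbabilityMeasure_map (h.measurable_noise 0).aemeasurable

/-- The indicator of `C` and `X n` together form an ℱ n-measurable vector, independent of `E n`.
Their joint law is then a product and Tonelli applies. This replaces conditional expectations in the
one-step estimates. -/
theorem NoiseDriven.setLIntegral_noise (h : NoiseDriven μ ν F ℱ X E) (n : ℕ) {C : Set Ω}
    (hC : MeasurableSet[ℱ n] C) {f : S × ℝ → ℝ≥0∞} (hf : Measurable f) :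
    ∫⁻ ω in C, f (X n ω, E n ω) ∂μ = ∫⁻ ω in C, ∫⁻ e, f (X n ω, e) ∂ν ∂μ := by
  have := h.isProbabilityMeasure
  have hC' : MeasurableSet C := ℱ.le n _ hC
  have hX : Measurable (X n) := (h.adapted n).mono (ℱ.le n) le_rfl
  let Y : Ω → ℝ≥0∞ × S := fun ω => (C.indicator 1 ω, X n ω)
  have hYn : Measurable[ℱ n] Y :=
    Measurable.prodMk ((@measurable_const _ _ _ (ℱ n) 1).indicator hC) (h.adapted n)
  have hY : Measurable Y := hYn.mono (ℱ.le n) le_rfl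
  have hind : IndepFun Y (E n) μ := by
    rw [IndepFun_iff_Indep]
    exact (indep_of_indep_of_le_right (h.indep n) hYn.comap_le).symm
  have hmap := (indepFun_iff_map_prod_eq_prod_map_map hY.aemeasurable
    (h.measurable_noise n).aemeasurable).1 hind
  rw [h.map_noise n] at hmap
  let G : (ℝ≥0∞ × S) × ℝ → ℝ≥0∞ := fun z => z.1.1 * f (z.1.2, z.2)
  have hG : Measurable G := by fun_prop
  have h1 : ∫⁻ ω, G (Y ω, E n ω) ∂μ = ∫⁻ ω, ∫⁻ e, G (Y ω, e) ∂ν ∂μ := by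
    rw [← lintegral_map hG (hY.prodMk (h.measurable_noise n)), hmap,
      lintegral_prod _ hG.aemeasurable,
      lintegral_map hG.lintegral_prod_right' hY]
  have key : ∀ g : Ω → ℝ≥0∞, ∫⁻ ω in C, g ω ∂μ = ∫⁻ ω, C.indicator 1 ω * g ω ∂μ := by
    intro g
    rw [← lintegral_indicator hC']
    refine lintegral_congr fun ω => ?_
    by_cases hω : ω ∈ C <;> simp [hω]
  rw [key, key]
  refine h1.trans (lintegral_congr fun ω => ?_)
  exact lintegral_const_mul _ (by fun_prop)

theorem NoiseDriven.setLIntegral_noise_le (h : NoiseDriven μ ν F ℱ X E) (n : ℕ) {C : Set Ω}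
    (hC : MeasurableSet[ℱ n] C) {f : S × ℝ → ℝ≥0∞} (hf : Measurable f) {g : S → ℝ≥0∞}
    (hfg : ∀ ω ∈ C, ∫⁻ e, f (X n ω, e) ∂ν ≤ g (X n ω)) :
    ∫⁻ ω in C, f (X n ω, E n ω) ∂μ ≤ ∫⁻ ω in C, g (X n ω) ∂μ := by
  rw [h.setLIntegral_noise n hC hf]
  exact setLIntegral_mono' (ℱ.le n _ hC) hfg

theorem NoiseDriven.le_measure_step (h : NoiseDriven μ ν F ℱ X E) (n : ℕ) {C : Set Ω}
    (hC : MeasurableSet[ℱ n] C) {B : Set S} (hB : MeasurableSet B) {c : ℝ≥0∞}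
    (hc : ∀ ω ∈ C, c ≤ ν {e | F (X n ω) e ∈ B}) :
    c * μ C ≤ μ (C ∩ {ω | X (n + 1) ω ∈ B}) := by
  have hC' : MeasurableSet C := ℱ.le n _ hC
  have hX : Measurable (X (n + 1)) := (h.adapted (n + 1)).mono (ℱ.le (n + 1)) le_rfl
  have hD : MeasurableSet {z : S × ℝ | F z.1 z.2 ∈ B} := h.measurable_map hB
  have h1 := h.setLIntegral_noise n hC (f := {z : S × ℝ | F z.1 z.2 ∈ B}.indicator 1)
    (measurable_one.indicator hD)
  have h2 : ∫⁻ ω in C, {z : S × ℝ | F z.1 z.2 ∈ B}.indicator 1 (X n ω, E n ω) ∂μ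
      = μ (C ∩ {ω | X (n + 1) ω ∈ B}) := by
    have hXB : MeasurableSet {ω | X (n + 1) ω ∈ B} := hX hB
    rw [inter_comm, ← Measure.restrict_apply hXB, ← lintegral_indicator_one hXB]
    refine lintegral_congr fun ω => ?_
    have hiff : X (n + 1) ω ∈ B ↔ F (X n ω) (E n ω) ∈ B := by rw [h.succ]
    by_cases hb : F (X n ω) (E n ω) ∈ B <;> simp [hiff, hb]
  rw [← h2, h1, ← setLIntegral_const]
  refine setLIntegral_mono' hC' fun ω hω => (hc ω hω).trans (le_of_eq ?_)
  rw [← lintegral_indicator_one]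
  · rfl
  · exact h.measurable_map.comp measurable_prodMk_left hB

/-- From any state in `B`, whatever the past, the event `A` has conditional probability at least
`c`. -/
def LeadsTo (μ : Measure Ω) (ℱ : Filtration ℕ mΩ) (X : ℕ → Ω → S) (A : Set Ω) (c : ℝ≥0∞)
    (B : Set S) : Prop :=
  ∀ n C, MeasurableSet[ℱ n] C → (∀ ω ∈ C, X n ω ∈ B) → c * μ C ≤ μ (C ∩ A)

omit [MeasurableSpace S] [IsProbabilityMeasure μ] in
theorem LeadsTo.mono {A : Set Ω} {c c' : ℝ≥0∞} {B B' : Set S} (h : LeadsTo μ ℱ X A c B)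
    (hc : c' ≤ c) (hB : B' ⊆ B) : LeadsTo μ ℱ X A c' B' := fun n C hC hCB =>
  (mul_le_mul_left hc _).trans (h n C hC fun ω hω => hB (hCB ω hω))

omit [IsProbabilityMeasure μ] in
theorem LeadsTo.union (hX : ∀ n, Measurable[ℱ n] (X n)) {A : Set Ω} {c : ℝ≥0∞} {B B' : Set S}
    (hBm : MeasurableSet B) (h : LeadsTo μ ℱ X A c B) (h' : LeadsTo μ ℱ X A c B') :
    LeadsTo μ ℱ X A c (B ∪ B') := by
  intro n C hC hCB
  have hD : MeasurableSet[ℱ n] (X n ⁻¹' B) := hX n hBm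
  have h1 := h n (C ∩ X n ⁻¹' B) (hC.inter hD) fun ω hω => hω.2
  have h2 := h' n (C \ X n ⁻¹' B) (hC.diff hD) fun ω hω => (hCB ω hω.1).resolve_left hω.2
  have hD' := ℱ.le n _ hD
  rw [← measure_inter_add_sdiff C hD', ← measure_inter_add_sdiff (C ∩ A) hD', mul_add]
  refine add_le_add (h1.trans (measure_mono ?_)) (h2.trans (measure_mono ?_))
  · rintro ω ⟨⟨a, b⟩, c⟩; exact ⟨⟨a, c⟩, b⟩
  · rintro ω ⟨⟨a, b⟩, c⟩; exact ⟨⟨a, c⟩, b⟩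

/-- Chaining: the part of `C` that enters `B'` at the next time is an event of ℱ (n + 1), to which
the bound for `B'` applies. -/
theorem LeadsTo.step (hN : NoiseDriven μ ν F ℱ X E) {A : Set Ω} {c c' : ℝ≥0∞} {B B' : Set S}
    (hBm : MeasurableSet B') (h : LeadsTo μ ℱ X A c B')
    (hc : ∀ s ∈ B, c' ≤ ν {e | F s e ∈ B'}) : LeadsTo μ ℱ X A (c * c') B := by
  intro n C hC hCB
  have h1 := hN.le_measure_step n hC hBm fun ω hω => hc _ (hCB ω hω)
  have hC' : MeasurableSet[ℱ (n + 1)] (C ∩ {ω | X (n + 1) ω ∈ B'}) :=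
    MeasurableSet.inter (ℱ.mono n.le_succ _ hC) (hN.adapted (n + 1) hBm)
  calc c * c' * μ C = c * (c' * μ C) := mul_assoc _ _ _
    _ ≤ c * μ (C ∩ {ω | X (n + 1) ω ∈ B'}) := by gcongr
    _ ≤ μ (C ∩ {ω | X (n + 1) ω ∈ B'} ∩ A) := h (n + 1) _ hC' fun ω hω => hω.2
    _ ≤ μ (C ∩ A) := measure_mono fun ω hω => ⟨hω.1.1, hω.2⟩

/-- If `A` is likely from every state of `B`, and `B` is visited infinitely often outside `A`, then
`A` is almost sure. -/
theorem LeadsTo.ae_mem (hX : ∀ n, Measurable[ℱ n] (X n)) {A : Set Ω}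
    (hA : MeasurableSet[⨆ n, ℱ n] A) {c : ℝ≥0∞} (hc : 0 < c) {B : Set S} (hB : MeasurableSet B)
    (h : LeadsTo μ ℱ X A c B) (hfreq : ∀ᵐ ω ∂μ, ω ∉ A → ∃ᶠ n in atTop, X n ω ∈ B) :
    ∀ᵐ ω ∂μ, ω ∈ A := by
  have hA' : MeasurableSet A := (iSup_le fun n => ℱ.le n : (⨆ n, ℱ n) ≤ mΩ) _ hA
  -- Lowering `c` to 1 is harmless, and a finite `c` can be compared with real conditional
  -- expectations.
  wlog hct : c ≤ 1 generalizing c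
  · exact this (c := 1) one_pos (h.mono (le_of_not_ge hct) subset_rfl) le_rfl
  have hctop : c ≠ ∞ := (hct.trans_lt ENNReal.one_lt_top).ne
  set f : Ω → ℝ := A.indicator fun _ => 1 with hf
  have hfi : Integrable f μ := (integrable_const 1).indicator hA'
  have hlim := hfi.tendsto_ae_condExp (ℱ := ℱ)
    ((stronglyMeasurable_const (b := (1 : ℝ))).indicator hA)
  -- `LeadsTo` in terms of conditional probability: the event where it fails lies in ℱ n, and
  -- testing against it shows that it is null. By Lévy's theorem these probabilities tend to 0 off
  -- `A`, which contradicts visits to `B` infinitely often.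
  have hlow : ∀ n, ∀ᵐ ω ∂μ, X n ω ∈ B → c.toReal ≤ (μ[f | ℱ n]) ω := by
    intro n
    set C : Set Ω := X n ⁻¹' B ∩ {ω | (μ[f | ℱ n]) ω < c.toReal} with hCdef
    have hce : Measurable[ℱ n] (μ[f | ℱ n]) := stronglyMeasurable_condExp.measurable
    have hCm : MeasurableSet[ℱ n] C := (hX n hB).inter (hce measurableSet_Iio)
    have hCm' := ℱ.le n _ hCm
    have h1 : ∫ ω in C, (μ[f | ℱ n]) ω ∂μ = μ.real (C ∩ A) := by
      rw [setIntegral_condExp (ℱ.le n) hfi hCm, hf, setIntegral_indicator hA']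
      simp
    have h2 : c.toReal * μ.real C ≤ μ.real (C ∩ A) := by
      have := h n C hCm fun ω hω => hω.1
      have := ENNReal.toReal_mono (measure_ne_top _ _) this
      simpa [Measure.real] using this
    have h3 : ∫ ω in C, (c.toReal - (μ[f | ℱ n]) ω) ∂μ ≤ 0 := by
      rw [integral_sub (integrable_const _) integrable_condExp.integrableOn, h1]
      simp only [integral_const, smul_eq_mul, measureReal_restrict_apply_univ]
      linarith
    have h4 : 0 = μ C := by
      by_contra hne
      have hpos : 0 < ∫ ω in C, (c.toReal - (μ[f | ℱ n]) ω) ∂μ := by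
        rw [setIntegral_pos_iff_support_of_nonneg_ae]
        · refine (pos_iff_ne_zero.2 (Ne.symm hne)).trans_le (measure_mono ?_)
          intro ω hω
          exact ⟨(sub_pos.2 hω.2).ne', hω⟩
        · filter_upwards [ae_restrict_mem hCm'] with ω hω
          exact (sub_pos.2 hω.2).le
        · exact ((integrable_const _).sub integrable_condExp).integrableOn
      linarith
    have h5 : ∀ᵐ ω ∂μ, ω ∉ C := measure_eq_zero_iff_ae_notMem.1 h4.symm
    filter_upwards [h5] with ω hω hB
    by_contra hlt
    exact hω ⟨hB, not_le.1 hlt⟩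
  filter_upwards [hlim, hfreq, ae_all_iff.2 hlow] with ω h1 h2 h3
  by_contra hωA
  have h4 : f ω = 0 := indicator_of_notMem hωA _
  rw [h4] at h1
  have h5 : ∀ᶠ n in atTop, (μ[f | ℱ n]) ω < c.toReal :=
    h1.eventually_lt_const (ENNReal.toReal_pos hc.ne' hctop)
  obtain ⟨n, hn1, hn2⟩ := ((h2 hωA).and_eventually h5).exists
  exact absurd (h3 n hn1) (not_le.2 hn2)

end Chain

/-! ### The algorithm as a noise-driven recursion for (x, γ, y). -/

section Recursion

variable {Ω : Type*} [mΩ : MeasurableSpace Ω] {μ : Measure Ω} {u d gbar : ℝ} {φ : ℝ → ℝ}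
  {ξ x γ : ℕ → Ω → ℝ}

/-- One step of the algorithm, for the state `(x, γ, y)` and the next error `e`. -/
noncomputable def stepMap (u d gbar : ℝ) (φ : ℝ → ℝ) (s : ℝ × ℝ × ℝ) (e : ℝ) : ℝ × ℝ × ℝ :=
  (s.1 - s.2.1 * (φ s.1 + e),
    if 0 < s.2.2 * (φ s.1 + e) then min (u * s.2.1) gbar else d * s.2.1,
    φ s.1 + e)

/-- The state `(x, γ, y)` at time `n + 1`. -/
def state (φ : ℝ → ℝ) (ξ x γ : ℕ → Ω → ℝ) (n : ℕ) (ω : Ω) : ℝ × ℝ × ℝ :=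
  (x (n + 1) ω, γ (n + 1) ω, obs φ ξ x (n + 1) ω)

theorem IsProcess.state_succ (h : IsProcess u d gbar φ ξ x γ) (n : ℕ) (ω : Ω) :
    state φ ξ x γ (n + 1) ω = stepMap u d gbar φ (state φ ξ x γ n ω) (ξ (n + 2) ω) := by
  have h1 := h.x_step (n + 2) (by omega) ω
  have h2 := h.γ_step (n + 2) (by omega) ω
  simp only [state, stepMap, Prod.mk.injEq]
  refine ⟨?_, ?_, ?_⟩
  · rw [h1]; simp [obs]
  · rw [h2]; simp [obs]
  · simp [obs]

theorem IsProcess.measurable_obs (hφ : Measurable φ) (hξ : ∀ t, Measurable (ξ t)) {t : ℕ}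
    (hx : Measurable (x (t - 1))) : Measurable (obs φ ξ x t) :=
  (hφ.comp hx).add (hξ t)

theorem IsProcess.measurable_x (h : IsProcess u d gbar φ ξ x γ) (hφ : Measurable φ)
    (hξ : ∀ t, Measurable (ξ t)) (t : ℕ) : Measurable (x t) ∧ Measurable (γ t) := by
  have hite : ∀ {f k : Ω → ℝ}, Measurable f → Measurable k → ∀ {a : Ω → ℝ}, Measurable a →
      Measurable fun ω => if 0 < f ω * k ω then min (u * a ω) gbar else d * a ω := by
    intro f k hf hk a ha
    exact Measurable.ite (measurableSet_lt measurable_const (hf.mul hk))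
      ((ha.const_mul u).min measurable_const) (ha.const_mul d)
  -- Two consecutive times are carried along, because γ_{t+2} involves y_{t+1} and y_{t+2}, hence
  -- both x_t and x_{t+1}.
  have key : ∀ t, Measurable (x t) ∧ Measurable (γ t) ∧ Measurable (x (t + 1)) ∧
      Measurable (γ (t + 1)) := by
    intro t
    induction t with
    | zero =>
      refine ⟨h.measurable_x_zero, h.measurable_γ_zero, ?_, h.measurable_γ_one⟩
      rw [show x (0 + 1) = fun ω => x 0 ω - γ 0 ω * obs φ ξ x 1 ω from
        funext (h.x_step 1 le_rfl)]
      exact h.measurable_x_zero.sub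
        (h.measurable_γ_zero.mul (measurable_obs hφ hξ h.measurable_x_zero))
    | succ t ih =>
      obtain ⟨h1, h2, h3, h4⟩ := ih
      refine ⟨h3, h4, ?_, ?_⟩
      · rw [show x (t + 1 + 1) = fun ω => x (t + 1) ω - γ (t + 1) ω * obs φ ξ x (t + 2) ω from
          funext (h.x_step (t + 2) (by omega))]
        exact h3.sub (h4.mul (measurable_obs hφ hξ h3))
      · rw [show γ (t + 1 + 1) = _ from funext (h.γ_step (t + 2) (by omega))]
        exact hite (measurable_obs hφ hξ h1) (measurable_obs hφ hξ h3) h4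
  exact ⟨(key t).1, (key t).2.1⟩

omit mΩ in
theorem history_mono (ξ x γ : ℕ → Ω → ℝ) {s t : ℕ} (h : s ≤ t) :
    history ξ x γ s ≤ history ξ x γ t :=
  biSup_mono fun i hi => by simp only [Finset.mem_range] at hi ⊢; omega

theorem history_le (hx : ∀ t, Measurable (x t)) (hγ : ∀ t, Measurable (γ t))
    (hξ : ∀ t, Measurable (ξ t)) (t : ℕ) : history ξ x γ t ≤ mΩ :=
  iSup₂_le fun i _ => sup_le (sup_le (hx i).comap_le (hγ i).comap_le) (hξ i).comap_le

omit mΩ in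
theorem measurable_history (ξ x γ : ℕ → Ω → ℝ) {i t : ℕ} (hi : i ≤ t) :
    Measurable[history ξ x γ t] (x i) ∧ Measurable[history ξ x γ t] (γ i) ∧
      Measurable[history ξ x γ t] (ξ i) := by
  have hle := le_iSup₂ (f := fun i (_ : i ∈ Finset.range (t + 1)) =>
    (MeasurableSpace.comap (x i) inferInstance ⊔ MeasurableSpace.comap (γ i) inferInstance ⊔
      MeasurableSpace.comap (ξ i) inferInstance)) i (Finset.mem_range.2 (Nat.lt_succ_of_le hi))
  refine ⟨?_, ?_, ?_⟩
  · exact measurable_iff_comap_le.2 ((le_sup_left.trans le_sup_left).trans hle)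
  · exact measurable_iff_comap_le.2 ((le_sup_right.trans le_sup_left).trans hle)
  · exact measurable_iff_comap_le.2 (le_sup_right.trans hle)

/-- The histories from time `1` on, as a filtration. -/
def historyFiltration (ξ x γ : ℕ → Ω → ℝ) (hle : ∀ t, history ξ x γ t ≤ mΩ) : Filtration ℕ mΩ where
  seq n := history ξ x γ (n + 1)
  mono' _ _ hij := history_mono ξ x γ (Nat.succ_le_succ hij)
  le' n := hle (n + 1)

theorem measurable_stepMap (hφ : Measurable φ) :
    Measurable (Function.uncurry (stepMap u d gbar φ)) := by
  have hy : Measurable fun z : (ℝ × ℝ × ℝ) × ℝ => φ z.1.1 + z.2 :=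
    (hφ.comp (measurable_fst.comp measurable_fst)).add measurable_snd
  have hx : Measurable fun z : (ℝ × ℝ × ℝ) × ℝ => z.1.1 := by fun_prop
  have hg : Measurable fun z : (ℝ × ℝ × ℝ) × ℝ => z.1.2.1 := by fun_prop
  have hs : Measurable fun z : (ℝ × ℝ × ℝ) × ℝ => z.1.2.2 := by fun_prop
  exact (hx.sub (hg.mul hy)).prodMk ((Measurable.ite
    (measurableSet_lt measurable_const (hs.mul hy)) ((hg.const_mul u).min measurable_const)
    (hg.const_mul d)).prodMk hy)

/-- Index n stands for time n + 1, the first time at which an observation y exists. The next error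
is then ξ_{n+2}, independent of F_{n+1} by `A1`. -/
theorem IsProcess.noiseDriven (h : IsProcess u d gbar φ ξ x γ) (hφ : Measurable φ)
    (hξ : ∀ t, Measurable (ξ t)) (hA1 : A1 μ ξ x γ) (hA2 : A2 μ ξ)
    (hle : ∀ t, history ξ x γ t ≤ mΩ) :
    NoiseDriven μ (μ.map (ξ 1)) (stepMap u d gbar φ) (historyFiltration ξ x γ hle)
      (state φ ξ x γ) fun n => ξ (n + 2) where
  measurable_map := measurable_stepMap hφ
  adapted n := by
    obtain ⟨h1, h2, h3⟩ := measurable_history ξ x γ (le_refl (n + 1))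
    obtain ⟨h4, -, -⟩ := measurable_history ξ x γ (Nat.le_succ n)
    exact h1.prodMk (h2.prodMk ((hφ.comp h4).add h3))
  measurable_noise n := hξ _
  map_noise n := (hA2.1 (n + 2) (by omega)).map_eq
  indep n := hA1 (n + 1)
  succ := h.state_succ

theorem IsProcess.γ_mem (h : IsProcess u d gbar φ ξ x γ) (hd0 : 0 < d) (hd1 : d < 1) (hu : 1 < u)
    (t : ℕ) (ω : Ω) : γ t ω ∈ Ioc 0 gbar := by
  induction t with
  | zero => exact h.γ_zero_mem ω
  | succ t ih =>
    rcases Nat.eq_zero_or_pos t with rfl | ht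
    · exact h.γ_one_mem ω
    · rw [h.γ_step (t + 1) (by omega) ω, Nat.add_sub_cancel]
      obtain ⟨h1, h2⟩ := ih
      split_ifs
      · exact ⟨lt_min (by positivity) (h1.trans_le h2), min_le_right _ _⟩
      · exact ⟨by positivity, by nlinarith⟩

end Recursion

/-! ### A primitive of φ as a Lyapunov function. -/

section Potential

variable {φ : ℝ → ℝ} {M : ℝ}

theorem A4.abs_sub_le (h : A4 φ) (a b : ℝ) : |φ a - φ b| ≤ derivBound φ * |a - b| := by
  have hd : Differentiable ℝ φ := h.1.differentiable one_ne_zero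
  have := Convex.norm_image_sub_le_of_norm_deriv_le (s := univ) (f := φ) (C := derivBound φ)
    (x := b) (y := a) (fun x _ => hd x)
    (fun x _ => by rw [Real.norm_eq_abs]; exact le_ciSup h.2 x) convex_univ trivial trivial
  simpa [Real.norm_eq_abs] using this

/-- φ has opposite signs at R and -R, so it is not constant. Positivity allows `A5` to be used as ḡM
< 2. -/
theorem derivBound_pos (h : A4 φ) {R : ℝ} (hR : 0 < R) (hφ : ∀ x, R ≤ |x| → 0 < x * φ x) :
    0 < derivBound φ := by
  have h1 := hφ R (le_abs_self R)
  have h2 := hφ (-R) (by rw [abs_neg]; exact le_abs_self R)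
  have h3 := h.abs_sub_le R (-R)
  have h4 : 0 < φ R := pos_of_mul_pos_right h1 hR.le
  have h5 : φ (-R) < 0 := by nlinarith
  have h6 : 0 < |φ R - φ (-R)| := abs_pos.2 (by linarith)
  have h7 : 0 < |R - -R| := abs_pos.2 (by linarith)
  exact pos_of_mul_pos_left (h6.trans_le h3) h7.le

/-- The descent inequality for a primitive of a Lipschitz function. -/
theorem descent_of_lipschitz {Φ : ℝ → ℝ} (hΦ : ∀ x, HasDerivAt Φ (φ x) x)
    (hφ : ∀ a b, |φ a - φ b| ≤ M * |a - b|) (x h : ℝ) :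
    Φ (x + h) ≤ Φ x + φ x * h + M / 2 * h ^ 2 := by
  -- G(0) = 0, and by the Lipschitz bound G'(t) = φ(x) + Mt - φ(x + t) has the sign of t, so G has
  -- its minimum at 0.
  set G : ℝ → ℝ := fun t => Φ x + φ x * t + M / 2 * t ^ 2 - Φ (x + t) with hG
  have hder : ∀ t, HasDerivAt G (φ x + M * t - φ (x + t)) t := by
    intro t
    have h1 : HasDerivAt (fun t => Φ (x + t)) (φ (x + t)) t := (hΦ (x + t)).comp_const_add x t
    have h2 : HasDerivAt (fun t => Φ x + φ x * t + M / 2 * t ^ 2)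
        (φ x * 1 + M / 2 * (2 * t)) t := by
      refine ((((hasDerivAt_id t).const_mul (φ x)).const_add (Φ x)).add
        ((hasDerivAt_pow 2 t).const_mul (M / 2))).congr_deriv ?_
      simp
    exact (h2.sub h1).congr_deriv (by ring)
  have hG0 : G 0 = 0 := by simp [hG]
  have hcont : Continuous G := continuous_iff_continuousAt.2 fun t => (hder t).continuousAt
  suffices 0 ≤ G h by simp only [hG] at this; linarith
  rcases le_total 0 h with hh | hh
  · have : MonotoneOn G (Ici 0) := by
      refine monotoneOn_of_deriv_nonneg (convex_Ici 0) hcont.continuousOn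
        (fun t _ => (hder t).differentiableAt.differentiableWithinAt) fun t ht => ?_
      rw [interior_Ici, mem_Ioi] at ht
      rw [(hder t).deriv]
      have := (abs_le.1 (hφ (x + t) x)).2
      rw [add_sub_cancel_left, abs_of_pos ht] at this
      linarith
    exact hG0 ▸ this self_mem_Ici hh hh
  · have : AntitoneOn G (Iic 0) := by
      refine antitoneOn_of_deriv_nonpos (convex_Iic 0) hcont.continuousOn
        (fun t _ => (hder t).differentiableAt.differentiableWithinAt) fun t ht => ?_
      rw [interior_Iic, mem_Iio] at ht
      rw [(hder t).deriv]
      have := (abs_le.1 (hφ (x + t) x)).1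
      rw [add_sub_cancel_left, abs_of_neg ht] at this
      linarith
    exact hG0 ▸ this hh self_mem_Iic hh

/-- A function with the sign of `x` for large `|x|` has a nonnegative primitive. -/
theorem exists_nonneg_primitive (hφ : Continuous φ) {R : ℝ} (hR : 0 < R)
    (hsign : ∀ x, R ≤ |x| → 0 < x * φ x) :
    ∃ Φ : ℝ → ℝ, (∀ x, HasDerivAt Φ (φ x) x) ∧ ∀ x, 0 ≤ Φ x := by
  set Ψ : ℝ → ℝ := fun x => ∫ t in (0 : ℝ)..x, φ t with hΨ
  have hder : ∀ x, HasDerivAt Ψ (φ x) x := fun x =>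
    intervalIntegral.integral_hasDerivAt_right (hφ.intervalIntegrable _ _)
      (hφ.stronglyMeasurableAtFilter _ _) hφ.continuousAt
  have hcont : Continuous Ψ := continuous_iff_continuousAt.2 fun t => (hder t).continuousAt
  -- The minimum over [-R, R] is global, as Ψ increases to the right of R and decreases to the left
  -- of -R. Subtracting it makes the primitive nonnegative.
  obtain ⟨z, -, hz⟩ := (isCompact_Icc (a := -R) (b := R)).exists_isMinOn
    ⟨0, by constructor <;> linarith⟩ hcont.continuousOn
  have hz' : ∀ y ∈ Icc (-R) R, Ψ z ≤ Ψ y := fun y hy => hz hy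
  refine ⟨fun x => Ψ x - Ψ z, fun x => (hder x).sub_const _, fun x => sub_nonneg.2 ?_⟩
  rcases le_total (-R) x with h1 | h1
  · rcases le_total x R with h2 | h2
    · exact hz' x ⟨h1, h2⟩
    · refine (hz' R ⟨by linarith, le_rfl⟩).trans ?_
      have : MonotoneOn Ψ (Ici R) := by
        refine monotoneOn_of_deriv_nonneg (convex_Ici R) hcont.continuousOn
          (fun t _ => (hder t).differentiableAt.differentiableWithinAt) fun t ht => ?_
        rw [interior_Ici, mem_Ioi] at ht
        rw [(hder t).deriv]
        exact (pos_of_mul_pos_right (hsign t (ht.le.trans (le_abs_self t))) (by linarith)).le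
      exact this self_mem_Ici h2 h2
  · refine (hz' (-R) ⟨le_rfl, by linarith⟩).trans ?_
    have : AntitoneOn Ψ (Iic (-R)) := by
      refine antitoneOn_of_deriv_nonpos (convex_Iic _) hcont.continuousOn
        (fun t _ => (hder t).differentiableAt.differentiableWithinAt) fun t ht => ?_
      rw [interior_Iic, mem_Iio] at ht
      rw [(hder t).deriv]
      have h3 := hsign t (by rw [abs_of_neg (by linarith)]; linarith)
      by_contra hneg
      push Not at hneg
      nlinarith
    exact this h1 self_mem_Iic h1

end Potential

/-! ### Weights for the last sign that make powers of the step size contract. -/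

section Weights

theorem eventually_neg_of_hasDerivAt {f : ℝ → ℝ} {f' : ℝ} (hf : HasDerivAt f f' 0)
    (h0 : f 0 = 0) (hneg : f' < 0) : ∀ᶠ t in 𝓝[>] (0 : ℝ), f t < 0 := by
  have h1 := (hasDerivAt_iff_tendsto_slope.1 hf).mono_left
    (nhdsWithin_mono 0 fun t (ht : t ∈ Ioi (0 : ℝ)) => ne_of_gt ht)
  filter_upwards [h1.eventually_lt_const hneg, self_mem_nhdsWithin] with t ht (htpos : 0 < t)
  rw [slope_def_field, h0, sub_zero, sub_zero] at ht
  by_contra hcon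
  exact absurd ht (not_lt.2 (div_nonneg (not_lt.1 hcon) htpos.le))

/-- A weighted mean of `exp (A θ) (1 + θ g)` is smaller than `1 + θ g₀` for small `θ > 0`, if this
is so to first order. -/
theorem eventually_mean_exp_lt {a b c A B C gA gB gC g : ℝ} (hsum : a + b + c = 1)
    (hneg : a * (A + gA) + b * (B + gB) + c * (C + gC) < g) :
    ∀ᶠ θ in 𝓝[>] (0 : ℝ), a * (Real.exp (A * θ) * (1 + θ * gA)) +
      b * (Real.exp (B * θ) * (1 + θ * gB)) + c * (Real.exp (C * θ) * (1 + θ * gC)) <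
        1 + θ * g := by
  have key : ∀ A gA : ℝ, HasDerivAt (fun θ => Real.exp (A * θ) * (1 + θ * gA)) (A + gA) 0 := by
    intro A gA
    have h1 : HasDerivAt (fun θ : ℝ => Real.exp (A * θ)) (Real.exp (A * 0) * (A * 1)) 0 :=
      ((hasDerivAt_id (0 : ℝ)).const_mul A).exp
    have h2 : HasDerivAt (fun θ : ℝ => 1 + θ * gA) (1 * gA) 0 :=
      ((hasDerivAt_id (0 : ℝ)).mul_const gA).const_add 1
    exact (h1.mul h2).congr_deriv (by simp)
  have h3 : HasDerivAt (fun θ : ℝ => 1 + θ * g) (1 * g) 0 :=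
    ((hasDerivAt_id (0 : ℝ)).mul_const g).const_add 1
  -- Both sides equal 1 at θ = 0, since the coefficients sum to 1; `hneg` compares their derivatives
  -- there.
  have h4 := (((((key A gA).const_mul a).add ((key B gB).const_mul b)).add
    ((key C gC).const_mul c)).sub h3)
  filter_upwards [eventually_neg_of_hasDerivAt h4 (by simp; linarith) (by linarith)] with θ hθ
  simp only [Pi.add_apply, Pi.sub_apply] at hθ
  linarith

theorem eventually_weight_pos (g : ℝ) : ∀ᶠ θ in 𝓝[>] (0 : ℝ), 0 < 1 + θ * g := by
  have h : Tendsto (fun θ : ℝ => 1 + θ * g) (𝓝[>] 0) (𝓝 (1 + 0 * g)) :=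
    (Continuous.tendsto (by fun_prop) 0).mono_left nhdsWithin_le_nhds
  exact h.eventually_const_lt (by simp)

/-- Finitely many strict inequalities survive a common factor close enough to 1. -/
theorem exists_contraction_factor {ι : Type*} [Finite ι] {a b : ι → ℝ} (h : ∀ i, a i < b i) :
    ∃ ρ : ℝ, 0 < ρ ∧ ρ < 1 ∧ ∀ i, a i ≤ ρ * b i := by
  have h1 : ∀ᶠ ρ in 𝓝[<] (1 : ℝ), ∀ i, a i ≤ ρ * b i := by
    rw [eventually_all]
    intro i
    have : Tendsto (fun ρ : ℝ => ρ * b i) (𝓝[<] 1) (𝓝 (1 * b i)) :=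
      (Continuous.tendsto (by fun_prop) 1).mono_left nhdsWithin_le_nhds
    filter_upwards [this.eventually_const_lt (by simpa using h i)] with ρ hρ using hρ.le
  obtain ⟨ρ, h2, h3, h4⟩ := (h1.and ((eventually_gt_nhds one_pos).filter_mono
    nhdsWithin_le_nhds |>.and self_mem_nhdsWithin)).exists
  exact ⟨ρ, h3, h4, h2⟩

variable {u d : ℝ}

theorem log_pos_neg (hd0 : 0 < d) (hd1 : d < 1) (hu : 1 < u) :
    0 < Real.log u ∧ Real.log d < 0 ∧
      critRatio u d = -Real.log d / (Real.log u - Real.log d) := by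
  refine ⟨Real.log_pos hu, Real.log_neg hd0 hd1, ?_⟩
  rw [critRatio, one_div, Real.log_inv, Real.log_div (by positivity) (by positivity)]

/-- Weights for the two signs that make a power of the step size contract, when signs agree with
probability below the critical ratio. -/
theorem exists_decay_weights {p q : ℝ} (hd0 : 0 < d) (hd1 : d < 1) (hu : 1 < u)
    (hpq : p + q = 1) (hk : p ^ 2 + q ^ 2 < critRatio u d) :
    ∃ θ a b ρ η : ℝ, 0 < θ ∧ θ ≤ 1 ∧ 0 < a ∧ 0 < b ∧ 0 < ρ ∧ ρ < 1 ∧ 0 < η ∧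
      (p + η) * (u ^ θ * a) + (q + η) * (d ^ θ * b) ≤ ρ * a ∧
      (p + η) * (d ^ θ * a) + (q + η) * (u ^ θ * b) ≤ ρ * b := by
  obtain ⟨hU, hD, hcr⟩ := log_pos_neg hd0 hd1 hu
  set U := Real.log u with hUdef
  set D := Real.log d with hDdef
  rw [hcr, lt_div_iff₀ (by linarith)] at hk
  obtain rfl : q = 1 - p := by linarith
  -- The mean increments of ln γ after a positive and after a negative sign, used as first-order
  -- corrections of the weights. With them both first-order conditions reduce to p g₁ + q g₂ < 0,
  -- that is (p² + q²)U + 2pqD < 0, which is `hk`.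
  set g₁ := p * U + (1 - p) * D with hg₁
  set g₂ := p * D + (1 - p) * U with hg₂
  have e1 := eventually_mean_exp_lt (a := p) (b := 1 - p) (c := 0) (A := U) (B := D) (C := 0)
    (gA := g₁) (gB := g₂) (gC := 0) (g := g₁) (by ring) (by rw [hg₁, hg₂]; nlinarith)
  have e2 := eventually_mean_exp_lt (a := p) (b := 1 - p) (c := 0) (A := D) (B := U) (C := 0)
    (gA := g₁) (gB := g₂) (gC := 0) (g := g₂) (by ring) (by rw [hg₁, hg₂]; nlinarith)
  obtain ⟨θ, h1, h2, h3, h4, h5, h6⟩ := (e1.and (e2.and ((eventually_weight_pos g₁).and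
    ((eventually_weight_pos g₂).and (((eventually_le_nhds one_pos).filter_mono
      nhdsWithin_le_nhds).and self_mem_nhdsWithin))))).exists
  have hup : Real.exp (U * θ) = u ^ θ := (Real.rpow_def_of_pos (by positivity) θ).symm
  have hdp : Real.exp (D * θ) = d ^ θ := (Real.rpow_def_of_pos hd0 θ).symm
  rw [hup, hdp] at h1 h2
  set a := 1 + θ * g₁
  set b := 1 + θ * g₂
  -- The slack η allows for φ(x) being small rather than zero.
  have e3 : ∀ᶠ η in 𝓝[>] (0 : ℝ),
      (p + η) * (u ^ θ * a) + (1 - p + η) * (d ^ θ * b) < a := by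
    have : Tendsto (fun η : ℝ => (p + η) * (u ^ θ * a) + (1 - p + η) * (d ^ θ * b)) (𝓝[>] 0)
        (𝓝 ((p + 0) * (u ^ θ * a) + (1 - p + 0) * (d ^ θ * b))) :=
      (Continuous.tendsto (by fun_prop) 0).mono_left nhdsWithin_le_nhds
    exact this.eventually_lt_const (by linarith)
  have e4 : ∀ᶠ η in 𝓝[>] (0 : ℝ),
      (p + η) * (d ^ θ * a) + (1 - p + η) * (u ^ θ * b) < b := by
    have : Tendsto (fun η : ℝ => (p + η) * (d ^ θ * a) + (1 - p + η) * (u ^ θ * b)) (𝓝[>] 0)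
        (𝓝 ((p + 0) * (d ^ θ * a) + (1 - p + 0) * (u ^ θ * b))) :=
      (Continuous.tendsto (by fun_prop) 0).mono_left nhdsWithin_le_nhds
    exact this.eventually_lt_const (by linarith)
  obtain ⟨η, h7, h8, h9⟩ := (e3.and (e4.and self_mem_nhdsWithin)).exists
  obtain ⟨ρ, hρ0, hρ1, hρ⟩ := exists_contraction_factor
    (a := ![(p + η) * (u ^ θ * a) + (1 - p + η) * (d ^ θ * b),
      (p + η) * (d ^ θ * a) + (1 - p + η) * (u ^ θ * b)]) (b := ![a, b])
    (by intro i; fin_cases i; exacts [h7, h8])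
  exact ⟨θ, a, b, ρ, η, h6, h5, h3, h4, hρ0, hρ1, h9, hρ 0, hρ 1⟩

/-- Weights for the three signs that make a negative power of the step size contract, when signs
agree with probability above the critical ratio; where the step size cannot grow, a probability
`κ` of being killed makes up for it. -/
theorem exists_growth_weights {α β κ : ℝ} (hd0 : 0 < d) (hd1 : d < 1) (hu : 1 < u)
    (hα : 0 ≤ α) (hβ : 0 ≤ β) (hk : critRatio u d < α ^ 2 + β ^ 2) (hκ : 0 < κ) :
    ∃ θ a b c ρ : ℝ, 0 < θ ∧ 0 < a ∧ 0 < b ∧ a ≤ c ∧ b ≤ c ∧ 0 < ρ ∧ ρ < 1 ∧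
      α * (u ^ (-θ) * a) + β * (d ^ (-θ) * b) + (1 - α - β) * (d ^ (-θ) * c) ≤ ρ * a ∧
      α * (d ^ (-θ) * a) + β * (u ^ (-θ) * b) + (1 - α - β) * (d ^ (-θ) * c) ≤ ρ * b ∧
      α * (d ^ (-θ) * a) + β * (d ^ (-θ) * b) + (1 - α - β) * (d ^ (-θ) * c) ≤ ρ * c ∧
      (1 - κ) * (d ^ (-θ) * c) ≤ ρ * a ∧ (1 - κ) * (d ^ (-θ) * c) ≤ ρ * b := by
  obtain ⟨hU, hD, hcr⟩ := log_pos_neg hd0 hd1 hu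
  set U := Real.log u with hUdef
  set D := Real.log d with hDdef
  rw [hcr, div_lt_iff₀ (by linarith)] at hk
  -- Minus the mean increments of ln γ when only probabilities α and β of the two signs are
  -- guaranteed and the remaining mass counts as shrinking. The correction for the third sign is -D.
  -- All three conditions reduce to (α² + β²)U + (1 - α² - β²)D > 0.
  set g₁ := -(α * U + (1 - α) * D) with hg₁
  set g₂ := -(β * U + (1 - β) * D) with hg₂
  have hsum : α + β + (1 - α - β) = 1 := by ring
  have e1 := eventually_mean_exp_lt (A := -U) (B := -D) (C := -D)
    (gA := g₁) (gB := g₂) (gC := -D) (g := g₁) hsum (by rw [hg₁, hg₂]; nlinarith)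
  have e2 := eventually_mean_exp_lt (A := -D) (B := -U) (C := -D)
    (gA := g₁) (gB := g₂) (gC := -D) (g := g₂) hsum (by rw [hg₁, hg₂]; nlinarith)
  have e3 := eventually_mean_exp_lt (A := -D) (B := -D) (C := -D)
    (gA := g₁) (gB := g₂) (gC := -D) (g := -D) hsum (by rw [hg₁, hg₂]; nlinarith)
  -- As θ → 0 the two sides tend to 1 - κ and 1, so the loss κ absorbs every effect of order θ.
  have e4 : ∀ g, ∀ᶠ θ in 𝓝[>] (0 : ℝ),
      (1 - κ) * (Real.exp (-D * θ) * (1 + θ * -D)) < 1 + θ * g := by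
    intro g
    have h1 : Tendsto (fun θ : ℝ => 1 + θ * g - (1 - κ) * (Real.exp (-D * θ) * (1 + θ * -D)))
        (𝓝[>] 0) (𝓝 (1 + 0 * g - (1 - κ) * (Real.exp (-D * 0) * (1 + 0 * -D)))) :=
      (Continuous.tendsto (by fun_prop) 0).mono_left nhdsWithin_le_nhds
    filter_upwards [h1.eventually_const_lt (by simpa using hκ)] with θ hθ
    linarith
  obtain ⟨θ, h1, h2, h3, h4, h5, h6, h7, h8⟩ := (e1.and (e2.and (e3.and ((e4 g₁).and
    ((e4 g₂).and ((eventually_weight_pos g₁).and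
    ((eventually_weight_pos g₂).and self_mem_nhdsWithin))))))).exists
  have h8 : 0 < θ := h8
  have hup : Real.exp (-U * θ) = u ^ (-θ) := by
    rw [Real.rpow_def_of_pos (by positivity)]; congr 1; ring
  have hdp : Real.exp (-D * θ) = d ^ (-θ) := by rw [Real.rpow_def_of_pos hd0]; congr 1; ring
  rw [hdp] at h1 h2 h3 h4 h5
  rw [hup] at h1 h2
  set a := 1 + θ * g₁ with ha
  set b := 1 + θ * g₂ with hb
  set c := 1 + θ * -D with hc
  obtain ⟨ρ, hρ0, hρ1, hρ⟩ := exists_contraction_factor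
    (a := ![α * (u ^ (-θ) * a) + β * (d ^ (-θ) * b) + (1 - α - β) * (d ^ (-θ) * c),
      α * (d ^ (-θ) * a) + β * (u ^ (-θ) * b) + (1 - α - β) * (d ^ (-θ) * c),
      α * (d ^ (-θ) * a) + β * (d ^ (-θ) * b) + (1 - α - β) * (d ^ (-θ) * c),
      (1 - κ) * (d ^ (-θ) * c), (1 - κ) * (d ^ (-θ) * c)]) (b := ![a, b, c, a, b])
    (by intro i; fin_cases i; exacts [h1, h2, h3, h4, h5])
  refine ⟨θ, a, b, c, ρ, h8, h6, h7, ?_, ?_, hρ0, hρ1, hρ 0, hρ 1, hρ 2, hρ 3, hρ 4⟩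
  · have : g₁ ≤ -D := by rw [hg₁]; nlinarith
    simp only [ha, hc]; gcongr
  · have : g₂ ≤ -D := by rw [hg₂]; nlinarith
    simp only [hb, hc]; gcongr

end Weights

/-! ### One-step mean estimates for the potential and for γ^θ. -/

section OneStep

variable {u d gbar : ℝ} {φ : ℝ → ℝ} {ν : Measure ℝ}

theorem lintegral_le_of_le_on_compl {f : ℝ → ℝ≥0∞} {A : Set ℝ} (hA : MeasurableSet A)
    {c₁ c₂ : ℝ≥0∞} (h1 : ∀ e ∈ A, f e ≤ c₁) (h2 : ∀ e ∉ A, f e ≤ c₂) :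
    ∫⁻ e, f e ∂ν ≤ c₁ * ν A + c₂ * ν Aᶜ := by
  rw [← lintegral_add_compl f hA, ← setLIntegral_const, ← setLIntegral_const]
  exact add_le_add (setLIntegral_mono' hA h1) (setLIntegral_mono' hA.compl h2)

/-- Mean decrease of the potential in one step. -/
theorem lintegral_potential_step_le [IsProbabilityMeasure ν] {Φ : ℝ → ℝ} {M S : ℝ}
    (hΦ : ∀ x h, Φ (x + h) ≤ Φ x + φ x * h + M / 2 * h ^ 2) (hΦ0 : ∀ x, 0 ≤ Φ x)
    (hi1 : Integrable (fun e => e) ν) (hi2 : Integrable (fun e => e ^ 2) ν)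
    (hm : ∫ e, e ∂ν = 0) (hS : ∫ e, e ^ 2 ∂ν = S) (s : ℝ × ℝ × ℝ) :
    ∫⁻ e, ENNReal.ofReal (Φ (stepMap u d gbar φ s e).1) ∂ν ≤ ENNReal.ofReal
      (Φ s.1 - s.2.1 * ((1 - M / 2 * s.2.1) * φ s.1 ^ 2 - M / 2 * s.2.1 * S)) := by
  set x := s.1
  set γ := s.2.1
  -- The descent bound for the displacement -γ(φ(x) + e), expanded in powers of e, so that only the
  -- mean 0 and the second moment S enter its integral.
  set f : ℝ → ℝ := fun e => (Φ x - γ * φ x ^ 2 + M / 2 * γ ^ 2 * φ x ^ 2) +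
    (M * γ ^ 2 * φ x - γ * φ x) * e + M / 2 * γ ^ 2 * e ^ 2 with hf
  have hle : ∀ e, Φ (stepMap u d gbar φ s e).1 ≤ f e := by
    intro e
    have := hΦ x (-(γ * (φ x + e)))
    simp only [stepMap, hf]
    rw [← sub_eq_add_neg] at this
    exact this.trans (le_of_eq (by ring))
  have hlin : Integrable (fun e => (Φ x - γ * φ x ^ 2 + M / 2 * γ ^ 2 * φ x ^ 2) +
    (M * γ ^ 2 * φ x - γ * φ x) * e) ν := (integrable_const _).add (hi1.const_mul _)
  have hi : Integrable f ν := hlin.add (hi2.const_mul _)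
  have hint : ∫ e, f e ∂ν =
      Φ x - γ * ((1 - M / 2 * γ) * φ x ^ 2 - M / 2 * γ * S) := by
    simp only [hf]
    rw [integral_add hlin (hi2.const_mul _),
      integral_add (integrable_const _) (hi1.const_mul _), integral_const_mul, integral_const_mul,
      hm, hS]
    simp
    ring
  calc ∫⁻ e, ENNReal.ofReal (Φ (stepMap u d gbar φ s e).1) ∂ν
      ≤ ∫⁻ e, ENNReal.ofReal (f e) ∂ν := lintegral_mono fun e => ENNReal.ofReal_le_ofReal (hle e)
    _ = ENNReal.ofReal (∫ e, f e ∂ν) := (ofReal_integral_eq_lintegral_ofReal hi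
        (ae_of_all _ fun e => (hΦ0 _).trans (hle e))).symm
    _ = _ := by rw [hint]

/-- Mean contraction of a power of the step size, where the sign probabilities are close to those
of the pure noise. -/
theorem lintegral_decay_step_le {θ a b ρ p q η : ℝ} (hd0 : 0 < d) (hd1 : d < 1) (hu : 1 < u)
    (hθ : 0 < θ) (ha : 0 < a) (hb : 0 < b) (hρ : 0 < ρ) (hp : 0 ≤ p + η) (hq : 0 ≤ q + η)
    (h1 : (p + η) * (u ^ θ * a) + (q + η) * (d ^ θ * b) ≤ ρ * a)
    (h2 : (p + η) * (d ^ θ * a) + (q + η) * (u ^ θ * b) ≤ ρ * b)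
    {s : ℝ × ℝ × ℝ} (hs : 0 < s.2.1) (hs' : s.2.1 ≤ gbar)
    (hpos : ν {e | 0 < φ s.1 + e} ≤ ENNReal.ofReal (p + η))
    (hneg : ν {e | 0 < φ s.1 + e}ᶜ ≤ ENNReal.ofReal (q + η)) :
    ∫⁻ e, ENNReal.ofReal ((stepMap u d gbar φ s e).2.1 ^ θ *
        if 0 < (stepMap u d gbar φ s e).2.2 then a else b) ∂ν ≤
      ENNReal.ofReal ρ * ENNReal.ofReal (s.2.1 ^ θ * if 0 < s.2.2 then a else b) := by
  set γ := s.2.1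
  have hA : MeasurableSet {e | 0 < φ s.1 + e} := measurableSet_lt (by fun_prop) (by fun_prop)
  have hdu : d ^ θ ≤ u ^ θ := Real.rpow_le_rpow hd0.le (by linarith) hθ.le
  have hγθ : 0 < γ ^ θ := Real.rpow_pos_of_pos hs θ
  have hmin : (min (u * γ) gbar) ^ θ ≤ u ^ θ * γ ^ θ := by
    rw [← Real.mul_rpow (by linarith) hs.le]
    exact Real.rpow_le_rpow (le_min (by positivity) (by linarith)) (min_le_left _ _) hθ.le
  have hdg : (d * γ) ^ θ = d ^ θ * γ ^ θ := Real.mul_rpow hd0.le hs.le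
  have hup : 0 < u ^ θ := Real.rpow_pos_of_pos (by linarith) θ
  have hdp : 0 < d ^ θ := Real.rpow_pos_of_pos hd0 θ
  -- The common part of both cases: c₁ and c₂ bound the growth factor times the new weight when the
  -- new observation is positive, respectively not.
  have fin : ∀ c₁ c₂ r : ℝ, 0 ≤ c₁ → 0 ≤ c₂ → (p + η) * c₁ + (q + η) * c₂ ≤ ρ * r →
      (∀ e, 0 < φ s.1 + e → (stepMap u d gbar φ s e).2.1 ^ θ * a ≤ γ ^ θ * c₁) →
      (∀ e, ¬ 0 < φ s.1 + e → (stepMap u d gbar φ s e).2.1 ^ θ * b ≤ γ ^ θ * c₂) →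
      ∫⁻ e, ENNReal.ofReal ((stepMap u d gbar φ s e).2.1 ^ θ *
        if 0 < (stepMap u d gbar φ s e).2.2 then a else b) ∂ν ≤
      ENNReal.ofReal ρ * ENNReal.ofReal (γ ^ θ * r) := by
    intro c₁ c₂ r hc₁ hc₂ hr hA1 hA2
    refine (lintegral_le_of_le_on_compl hA (c₁ := ENNReal.ofReal (γ ^ θ * c₁))
      (c₂ := ENNReal.ofReal (γ ^ θ * c₂)) ?_ ?_).trans ?_
    · intro e (he : 0 < φ s.1 + e)
      have : 0 < (stepMap u d gbar φ s e).2.2 := he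
      rw [if_pos this]
      exact ENNReal.ofReal_le_ofReal (hA1 e he)
    · intro e (he : ¬ 0 < φ s.1 + e)
      have : ¬ 0 < (stepMap u d gbar φ s e).2.2 := he
      rw [if_neg this]
      exact ENNReal.ofReal_le_ofReal (hA2 e he)
    · calc _ ≤ ENNReal.ofReal (γ ^ θ * c₁) * ENNReal.ofReal (p + η) +
            ENNReal.ofReal (γ ^ θ * c₂) * ENNReal.ofReal (q + η) := by gcongr
        _ = ENNReal.ofReal (γ ^ θ * c₁ * (p + η) + γ ^ θ * c₂ * (q + η)) := by
            rw [← ENNReal.ofReal_mul (by positivity), ← ENNReal.ofReal_mul (by positivity),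
              ← ENNReal.ofReal_add (by positivity) (by positivity)]
        _ ≤ ENNReal.ofReal (ρ * (γ ^ θ * r)) := by
            refine ENNReal.ofReal_le_ofReal ?_
            nlinarith [mul_le_mul_of_nonneg_left hr hγθ.le]
        _ = _ := ENNReal.ofReal_mul hρ.le
  by_cases hy : 0 < s.2.2
  · rw [if_pos hy]
    refine fin (u ^ θ * a) (d ^ θ * b) a (by positivity) (by positivity) h1 ?_ ?_
    · intro e he
      have : 0 < s.2.2 * (φ s.1 + e) := mul_pos hy he
      simp only [stepMap, if_pos this]
      nlinarith
    · intro e he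
      have : ¬ 0 < s.2.2 * (φ s.1 + e) := fun h => he (pos_of_mul_pos_right h hy.le)
      simp only [stepMap, if_neg this]
      exact le_of_eq (by rw [hdg]; ring)
  · rw [if_neg hy]
    refine fin (d ^ θ * a) (u ^ θ * b) b (by positivity) (by positivity) h2 ?_ ?_
    · intro e he
      have : ¬ 0 < s.2.2 * (φ s.1 + e) := fun h => hy (pos_of_mul_pos_left h he.le)
      simp only [stepMap, if_neg this]
      exact le_of_eq (by rw [hdg]; ring)
    · intro e he
      -- Zero observations are counted with the negative ones. They may cause a decrease here, which
      -- the larger factor u^θ also covers.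
      have : (stepMap u d gbar φ s e).2.1 ^ θ ≤ u ^ θ * γ ^ θ := by
        simp only [stepMap]
        split_ifs
        · exact hmin
        · rw [hdg]; gcongr
      nlinarith

end OneStep

/-! ### Summing integrals over events that a condition has held so far. -/

section Survival

variable {Ω : Type*} {mΩ : MeasurableSpace Ω} {μ : Measure Ω} {ℱ : Filtration ℕ mΩ}

/-- The event that `C` occurs and that `P j` occurs at all times `T ≤ j ≤ T + m`. -/
def survival (C : Set Ω) (P : ℕ → Set Ω) (T m : ℕ) : Set Ω := {ω | ω ∈ C ∧ ∀ i ≤ m, ω ∈ P (T + i)}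

omit mΩ in
theorem survival_succ_subset (C : Set Ω) (P : ℕ → Set Ω) (T m : ℕ) :
    survival C P T (m + 1) ⊆ survival C P T m :=
  fun _ hω => ⟨hω.1, fun i hi => hω.2 i (hi.trans m.le_succ)⟩

theorem measurableSet_survival {C : Set Ω} {P : ℕ → Set Ω} {T : ℕ}
    (hC : MeasurableSet[ℱ T] C) (hP : ∀ j, T ≤ j → MeasurableSet[ℱ j] (P j)) (m : ℕ) :
    MeasurableSet[ℱ (T + m)] (survival C P T m) := by
  have : survival C P T m = C ∩ ⋂ i ∈ Finset.range (m + 1), P (T + i) := by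
    ext ω; simp [survival]
  rw [this]
  refine MeasurableSet.inter (ℱ.mono (Nat.le_add_right T m) _ hC) ?_
  refine Finset.measurableSet_biInter _ fun i hi => ?_
  have : T + i ≤ T + m := by simp only [Finset.mem_range] at hi; omega
  exact ℱ.mono this _ (hP _ (Nat.le_add_right T i))

theorem tsum_le_of_telescope {a b : ℕ → ℝ≥0∞} (h : ∀ m, a (m + 1) + b m ≤ a m) :
    ∑' m, b m ≤ a 0 := by
  refine ENNReal.tsum_le_of_sum_range_le fun k => ?_
  have : a k + ∑ i ∈ Finset.range k, b i ≤ a 0 := by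
    induction k with
    | zero => simp
    | succ k ih =>
      rw [Finset.sum_range_succ, add_comm (Finset.sum _ _), ← add_assoc]
      exact (add_le_add_left (h k) _).trans ih
  exact le_add_self.trans this

theorem lintegral_tsum_indicator {K : ℕ → Set Ω} (hK : ∀ m, MeasurableSet (K m))
    {f : ℕ → Ω → ℝ≥0∞} (hf : ∀ m, Measurable (f m)) :
    ∫⁻ ω, ∑' m, (K m).indicator (f m) ω ∂μ = ∑' m, ∫⁻ ω in K m, f m ω ∂μ := by
  rw [lintegral_tsum fun m => ((hf m).indicator (hK m)).aemeasurable]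
  exact tsum_congr fun m => lintegral_indicator (hK m) _

/-- The indicators of the `K m` keep the total expectation finite, and on the intersection of the `K
m` they are all 1. -/
theorem ae_tsum_ne_top {K : ℕ → Set Ω} (hK : ∀ m, MeasurableSet (K m))
    {f : ℕ → Ω → ℝ≥0∞} (hf : ∀ m, Measurable (f m))
    (h : ∑' m, ∫⁻ ω in K m, f m ω ∂μ ≠ ∞) :
    ∀ᵐ ω ∂μ, (∀ m, ω ∈ K m) → ∑' m, f m ω ≠ ∞ := by
  rw [← lintegral_tsum_indicator hK hf] at h
  filter_upwards [ae_lt_top (Measurable.tsum fun m => (hf m).indicator (hK m)) h]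
    with ω hω hmem
  refine ne_of_lt (lt_of_eq_of_lt (tsum_congr fun m => ?_) hω)
  rw [indicator_of_mem (hmem m)]

theorem tsum_ne_top_of_shift {f : ℕ → ℝ≥0∞} (hf : ∀ n, f n ≠ ∞) (T : ℕ)
    (h : ∑' n, f (T + n) ≠ ∞) : ∑' n, f n ≠ ∞ := by
  rw [← Summable.sum_add_tsum_nat_add' (f := f) (k := T) ENNReal.summable]
  refine ENNReal.add_ne_top.2 ⟨ENNReal.sum_ne_top.2 fun i _ => hf i, ?_⟩
  simpa only [add_comm] using h

end Survival

/-! ### Recurrence or summable steps, and summability from small steps. -/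

section SummableSteps

variable {Ω : Type*} {mΩ : MeasurableSpace Ω} {μ : Measure Ω}
  [IsProbabilityMeasure μ] {ν : Measure ℝ} {u d gbar : ℝ} {φ : ℝ → ℝ} {ℱ : Filtration ℕ mΩ}
  {X : ℕ → Ω → ℝ × ℝ × ℝ} {E : ℕ → Ω → ℝ}

/-- The event that the step sizes are summable. -/
def summableSteps (X : ℕ → Ω → ℝ × ℝ × ℝ) : Set Ω :=
  {ω | ∑' n, ENNReal.ofReal (X n ω).2.1 ≠ ∞}

omit [IsProbabilityMeasure μ] in
theorem measurableSet_summableSteps (hX : ∀ n, Measurable[ℱ n] (X n)) :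
    MeasurableSet[⨆ n, ℱ n] (summableSteps X) := by
  have : ∀ n, Measurable[⨆ n, ℱ n] fun ω => ENNReal.ofReal (X n ω).2.1 := fun n =>
    ((measurable_fst.comp measurable_snd).ennreal_ofReal.comp (hX n)).mono
      (le_iSup (fun n => (ℱ n : MeasurableSpace Ω)) n) le_rfl
  have h2 : Measurable[⨆ n, ℱ n] fun ω => ∑' n, ENNReal.ofReal (X n ω).2.1 :=
    @Measurable.ennreal_tsum Ω (⨆ n, ℱ n) ℕ _ _ this
  exact (h2 (measurableSet_singleton ∞)).compl

/-- If outside `B` a nonnegative potential decreases in the mean, by a multiple of the step size,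
then `B` is visited infinitely often or the step sizes are summable. -/
theorem ae_frequently_mem (h : NoiseDriven μ ν (stepMap u d gbar φ) ℱ X E) {Φ : ℝ → ℝ}
    (hΦ : Measurable Φ) {δ : ℝ} (hδ : 0 < δ) {B : Set (ℝ × ℝ × ℝ)} (hB : MeasurableSet B)
    (hdrift : ∀ n ω, X n ω ∉ B →
      ∫⁻ e, ENNReal.ofReal (Φ (stepMap u d gbar φ (X n ω) e).1) ∂ν +
        ENNReal.ofReal δ * ENNReal.ofReal (X n ω).2.1 ≤ ENNReal.ofReal (Φ (X n ω).1)) :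
    ∀ᵐ ω ∂μ, ω ∉ summableSteps X → ∃ᶠ n in atTop, X n ω ∈ B := by
  have hXm : ∀ n, Measurable (X n) := fun n => (h.adapted n).mono (ℱ.le n) le_rfl
  -- Countably many starting times T and bounds N suffice. The bound makes the potential integrable
  -- at time T, and its expectation, while `B` is avoided, pays δ times the expected step at every
  -- time.
  have key : ∀ T N : ℕ, ∀ᵐ ω ∂μ, Φ (X T ω).1 ≤ N → (∀ n, T ≤ n → X n ω ∉ B) →
      ω ∈ summableSteps X := by
    intro T N
    set C : Set Ω := {ω | Φ (X T ω).1 ≤ N} with hC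
    have hCm : MeasurableSet[ℱ T] C :=
      (hΦ.comp (measurable_fst.comp (h.adapted T))) measurableSet_Iic
    set K : ℕ → Set Ω := survival C (fun j => X j ⁻¹' Bᶜ) T with hK
    have hKm : ∀ m, MeasurableSet[ℱ (T + m)] (K m) :=
      measurableSet_survival hCm fun j _ => h.adapted j hB.compl
    have hKm' : ∀ m, MeasurableSet (K m) := fun m => ℱ.le _ _ (hKm m)
    have hγm : ∀ n, Measurable fun ω => ENNReal.ofReal (X n ω).2.1 := fun n =>
      (measurable_fst.comp (measurable_snd.comp (hXm n))).ennreal_ofReal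
    set a : ℕ → ℝ≥0∞ := fun m => ∫⁻ ω in K m, ENNReal.ofReal (Φ (X (T + m) ω).1) ∂μ with ha
    set b : ℕ → ℝ≥0∞ := fun m => ∫⁻ ω in K m, ENNReal.ofReal (X (T + m) ω).2.1 ∂μ with hb
    have hstep : ∀ m, a (m + 1) + ENNReal.ofReal δ * b m ≤ a m := by
      intro m
      have h1 : a (m + 1) ≤ ∫⁻ ω in K m, ENNReal.ofReal (Φ (X (T + m + 1) ω).1) ∂μ :=
        lintegral_mono_set (survival_succ_subset _ _ _ _)
      have h2 : ∫⁻ ω in K m, ENNReal.ofReal (Φ (X (T + m + 1) ω).1) ∂μ =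
          ∫⁻ ω in K m, ∫⁻ e, ENNReal.ofReal
            (Φ (stepMap u d gbar φ (X (T + m) ω) e).1) ∂ν ∂μ := by
        rw [← h.setLIntegral_noise (T + m) (hKm m)
          (f := fun z => ENNReal.ofReal (Φ (stepMap u d gbar φ z.1 z.2).1))]
        · simp only [h.succ]
        · exact (hΦ.comp (measurable_fst.comp h.measurable_map)).ennreal_ofReal
      rw [h2] at h1
      simp only [hb]
      rw [← lintegral_const_mul _ (hγm _)]
      refine (add_le_add_left h1 _).trans ?_
      rw [← lintegral_add_right _ ((hγm _).const_mul _)]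
      exact setLIntegral_mono' (hKm' m) fun ω hω => hdrift _ _ (hω.2 m le_rfl)
    have ha0 : a 0 ≠ ∞ := by
      have : a 0 ≤ ∫⁻ _ in K 0, ENNReal.ofReal N ∂μ :=
        setLIntegral_mono' (hKm' 0) fun ω hω => ENNReal.ofReal_le_ofReal hω.1
      refine ne_top_of_le_ne_top ?_ this
      rw [setLIntegral_const]
      exact ENNReal.mul_ne_top ENNReal.ofReal_ne_top (measure_ne_top _ _)
    have hbsum : ∑' m, b m ≠ ∞ := by
      intro htop
      have := tsum_le_of_telescope (b := fun m => ENNReal.ofReal δ * b m) hstep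
      rw [ENNReal.tsum_mul_left, htop, ENNReal.mul_top (by simpa using hδ)] at this
      exact ha0 (top_le_iff.1 this)
    filter_upwards [ae_tsum_ne_top hKm' (fun m => hγm (T + m)) hbsum] with ω hω h1 h2
    refine tsum_ne_top_of_shift (fun n => ENNReal.ofReal_ne_top) T (hω fun m => ?_)
    exact ⟨h1, fun i _ => h2 _ (Nat.le_add_right T i)⟩
  filter_upwards [ae_all_iff.2 fun T => ae_all_iff.2 (key T)] with ω hω hnot
  rw [Filter.frequently_atTop]
  by_contra! hcon
  obtain ⟨T, hT⟩ := hcon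
  obtain ⟨N, hN⟩ := exists_nat_ge (Φ (X T ω).1)
  exact hnot (hω T N hN hT)

/-- Where the step size contracts as long as `|φ x| ≤ 2 ε`, small step sizes with `|φ x| ≤ ε` are
likely to be summable. -/
theorem exists_leadsTo_of_contraction (h : NoiseDriven μ ν (stepMap u d gbar φ) ℱ X E)
    (hφm : Measurable φ) (hγ : ∀ n ω, (X n ω).2.1 ∈ Ioc 0 gbar)
    {M : ℝ} (hM : 0 < M) (hLip : ∀ a b, |φ a - φ b| ≤ M * |a - b|)
    (hi1 : Integrable (fun e => e) ν) {θ a b ρ ε : ℝ} (hθ : 0 < θ) (hθ1 : θ ≤ 1)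
    (ha : 0 < a) (hb : 0 < b) (hρ0 : 0 < ρ) (hρ : ρ < 1) (hε : 0 < ε)
    (hcon : ∀ s : ℝ × ℝ × ℝ, 0 < s.2.1 → s.2.1 ≤ gbar → |φ s.1| ≤ 2 * ε →
      ∫⁻ e, ENNReal.ofReal ((stepMap u d gbar φ s e).2.1 ^ θ *
        if 0 < (stepMap u d gbar φ s e).2.2 then a else b) ∂ν ≤
      ENNReal.ofReal ρ * ENNReal.ofReal (s.2.1 ^ θ * if 0 < s.2.2 then a else b)) :
    ∃ γ₁ : ℝ, 0 < γ₁ ∧ LeadsTo μ ℱ X (summableSteps X) 2⁻¹ {s | |φ s.1| ≤ ε ∧ s.2.1 ≤ γ₁} := by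
  have := h.isProbabilityMeasure
  have hXm : ∀ n, Measurable (X n) := fun n => (h.adapted n).mono (ℱ.le n) le_rfl
  obtain ⟨ω₀⟩ : Nonempty Ω := (inferInstance : (NeZero μ)) |>.out |> fun hne => by
    by_contra hemp
    rw [not_nonempty_iff] at hemp
    exact hne (Measure.eq_zero_of_isEmpty μ)
  have hg : 0 < gbar := (hγ 0 ω₀).1.trans_le (hγ 0 ω₀).2
  set m₁ : ℝ := ∫ e, |e| ∂ν with hm₁
  have hm₁0 : 0 ≤ m₁ := integral_nonneg fun e => abs_nonneg e
  set V : ℝ × ℝ × ℝ → ℝ≥0∞ := fun s =>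
    ENNReal.ofReal (s.2.1 ^ θ * if 0 < s.2.2 then a else b) with hV
  have hVm : Measurable V := by
    refine Measurable.ennreal_ofReal (Measurable.mul ?_ (Measurable.ite ?_ measurable_const
      measurable_const))
    · exact (measurable_fst.comp measurable_snd).pow_const θ
    · exact measurableSet_lt measurable_const (measurable_snd.comp measurable_snd)
  set c₁ : ℝ := gbar ^ (1 - θ) * (1 + 2 * ε + m₁) / min a b with hc₁
  have hmin : 0 < min a b := lt_min ha hb
  have hmax : 0 < max a b := lt_max_of_lt_left ha
  have hc₁0 : 0 < c₁ := by positivity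
  -- Chosen so that the expectation of `Z` below is at most K₀ γ₁^θ (ε/M) μ(C), which equals half of
  -- (ε/M) μ(C) for this γ₁.
  set K₀ : ℝ := c₁ * (1 - ρ)⁻¹ * max a b * (M / ε) with hK₀
  have hρ' : 0 < (1 - ρ)⁻¹ := inv_pos.2 (by linarith)
  have hK₀0 : 0 < K₀ := by positivity
  set γ₁ : ℝ := (1 / (2 * K₀)) ^ θ⁻¹ with hγ₁
  have hγ₁θ : γ₁ ^ θ = 1 / (2 * K₀) := Real.rpow_inv_rpow (by positivity) hθ.ne'
  refine ⟨γ₁, by positivity, ?_⟩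
  intro n C hC hCB
  have hCm : MeasurableSet C := ℱ.le n _ hC
  set P : ℕ → Set Ω := fun j => {ω | |φ (X j ω).1| ≤ 2 * ε} with hP
  have hPm : ∀ j, n ≤ j → MeasurableSet[ℱ j] (P j) := fun j _ =>
    (hφm.abs.comp (measurable_fst.comp (h.adapted j))) measurableSet_Iic
  set K : ℕ → Set Ω := survival C P n with hK
  have hKm : ∀ m, MeasurableSet[ℱ (n + m)] (K m) := measurableSet_survival hC hPm
  have hKm' : ∀ m, MeasurableSet (K m) := fun m => ℱ.le _ _ (hKm m)
  set v : ℕ → ℝ≥0∞ := fun m => ∫⁻ ω in K m, V (X (n + m) ω) ∂μ with hv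
  have hvstep : ∀ m, v (m + 1) ≤ ENNReal.ofReal ρ * v m := by
    intro m
    calc v (m + 1) ≤ ∫⁻ ω in K m, V (X (n + m + 1) ω) ∂μ :=
          lintegral_mono_set (survival_succ_subset _ _ _ _)
      _ = ∫⁻ ω in K m, V (stepMap u d gbar φ (X (n + m) ω) (E (n + m) ω)) ∂μ := by
          simp only [h.succ]
      _ ≤ ∫⁻ ω in K m, ENNReal.ofReal ρ * V (X (n + m) ω) ∂μ :=
          h.setLIntegral_noise_le (n + m) (hKm m)
            (f := fun z => V (stepMap u d gbar φ z.1 z.2)) (g := fun s => ENNReal.ofReal ρ * V s)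
            (hVm.comp h.measurable_map)
            fun ω hω => hcon _ (hγ _ _).1 (hγ _ _).2 (hω.2 m le_rfl)
      _ = ENNReal.ofReal ρ * v m := lintegral_const_mul _ (hVm.comp (hXm _))
  have hvpow : ∀ m, v m ≤ ENNReal.ofReal ρ ^ m * v 0 := by
    intro m
    induction m with
    | zero => simp
    | succ m ih =>
      refine (hvstep m).trans ?_
      rw [pow_succ', mul_assoc]
      gcongr
  have hv0 : v 0 ≤ ENNReal.ofReal (γ₁ ^ θ * max a b) * μ C := by
    calc v 0 ≤ ∫⁻ ω in C, V (X (n + 0) ω) ∂μ := lintegral_mono_set fun ω hω => hω.1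
      _ ≤ ∫⁻ _ in C, ENNReal.ofReal (γ₁ ^ θ * max a b) ∂μ := by
          refine setLIntegral_mono' hCm fun ω hω => ENNReal.ofReal_le_ofReal ?_
          have h1 : (X n ω).2.1 ^ θ ≤ γ₁ ^ θ :=
            Real.rpow_le_rpow (hγ n ω).1.le (hCB ω hω).2 hθ.le
          have h2 : (if 0 < (X n ω).2.2 then a else b) ≤ max a b := by
            split_ifs
            exacts [le_max_left _ _, le_max_right _ _]
          have h3 : 0 ≤ (if 0 < (X n ω).2.2 then a else b) := by split_ifs <;> positivity
          exact mul_le_mul h1 h2 h3 (by positivity)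
      _ = _ := setLIntegral_const _ _
  have hvsum : ∑' m, v m ≤ ENNReal.ofReal ((1 - ρ)⁻¹ * (γ₁ ^ θ * max a b)) * μ C := by
    calc ∑' m, v m ≤ ∑' m, ENNReal.ofReal ρ ^ m * v 0 := ENNReal.tsum_le_tsum hvpow
      _ = (1 - ENNReal.ofReal ρ)⁻¹ * v 0 := by rw [ENNReal.tsum_mul_right, ENNReal.tsum_geometric]
      _ = ENNReal.ofReal ((1 - ρ)⁻¹) * v 0 := by
          rw [ENNReal.ofReal_inv_of_pos (by linarith), ENNReal.ofReal_sub _ hρ0.le,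
            ENNReal.ofReal_one]
      _ ≤ _ := by
          rw [ENNReal.ofReal_mul hρ'.le, mul_assoc]
          gcongr
  -- The term 1 accounts for the step size and |y| for the displacement of x, so one sum controls
  -- both.
  set f : ℕ → Ω → ℝ≥0∞ := fun m ω => ENNReal.ofReal
    ((X (n + m) ω).2.1 * (1 + |φ (X (n + m) ω).1 + E (n + m) ω|)) with hf
  set f₀ : (ℝ × ℝ × ℝ) × ℝ → ℝ≥0∞ := fun z =>
    ENNReal.ofReal (z.1.2.1 * (1 + |φ z.1.1 + z.2|)) with hf₀
  have hf₀m : Measurable f₀ := by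
    refine Measurable.ennreal_ofReal (Measurable.mul (by fun_prop) (Measurable.add
      measurable_const ?_))
    exact ((hφm.comp (measurable_fst.comp measurable_fst)).add measurable_snd).abs
  have hfm : ∀ m, Measurable (f m) := fun m =>
    hf₀m.comp ((hXm _).prodMk (h.measurable_noise _))
  have hf₀int : ∀ s : ℝ × ℝ × ℝ, 0 < s.2.1 → s.2.1 ≤ gbar → |φ s.1| ≤ 2 * ε →
      ∫⁻ e, f₀ (s, e) ∂ν ≤ ENNReal.ofReal c₁ * V s := by
    intro s hs1 hs2 hs3
    have hint : Integrable (fun e => s.2.1 * (1 + 2 * ε + |e|)) ν :=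
      ((integrable_const _).add hi1.abs).const_mul _
    have h1 : ∫⁻ e, f₀ (s, e) ∂ν ≤ ENNReal.ofReal (∫ e, s.2.1 * (1 + 2 * ε + |e|) ∂ν) := by
      rw [ofReal_integral_eq_lintegral_ofReal hint (ae_of_all _ fun e => by positivity)]
      refine lintegral_mono fun e => ENNReal.ofReal_le_ofReal ?_
      have := abs_add_le (φ s.1) e
      exact mul_le_mul_of_nonneg_left (by linarith) hs1.le
    have h2 : ∫ e, s.2.1 * (1 + 2 * ε + |e|) ∂ν = s.2.1 * (1 + 2 * ε + m₁) := by
      rw [integral_const_mul, integral_add (integrable_const _) hi1.abs]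
      simp [hm₁]
    refine h1.trans ?_
    rw [h2, hV, ← ENNReal.ofReal_mul hc₁0.le]
    refine ENNReal.ofReal_le_ofReal ?_
    -- This is where θ ≤ 1 is needed: γ is bounded by a multiple of the contracting quantity γ^θ.
    have h3 : s.2.1 ≤ gbar ^ (1 - θ) * s.2.1 ^ θ := by
      calc s.2.1 = s.2.1 ^ (1 - θ) * s.2.1 ^ θ := by
            rw [← Real.rpow_add hs1]; simp
        _ ≤ _ := by gcongr
    have h4 : min a b ≤ if 0 < s.2.2 then a else b := by
      split_ifs
      exacts [min_le_left _ _, min_le_right _ _]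
    calc s.2.1 * (1 + 2 * ε + m₁) ≤ gbar ^ (1 - θ) * s.2.1 ^ θ * (1 + 2 * ε + m₁) := by gcongr
      _ = c₁ * (s.2.1 ^ θ * min a b) := by rw [hc₁]; field_simp
      _ ≤ _ := by gcongr
  set Z : Ω → ℝ≥0∞ := fun ω => ∑' m, (K m).indicator (f m) ω with hZ
  have hZm : Measurable Z := Measurable.tsum fun m => (hfm m).indicator (hKm' m)
  have hZint : ∫⁻ ω, Z ω ∂μ ≤ ENNReal.ofReal (ε / M) * (2⁻¹ * μ C) := by
    have h1 : ∀ m, ∫⁻ ω in K m, f m ω ∂μ ≤ ENNReal.ofReal c₁ * v m := by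
      intro m
      simp only [hv]
      rw [← lintegral_const_mul (f := fun ω => V (X (n + m) ω)) _ (hVm.comp (hXm _))]
      exact h.setLIntegral_noise_le (n + m) (hKm m) hf₀m
        (g := fun s => ENNReal.ofReal c₁ * V s)
        fun ω hω => hf₀int _ (hγ _ _).1 (hγ _ _).2 (hω.2 m le_rfl)
    rw [hZ, lintegral_tsum_indicator hKm' hfm]
    calc ∑' m, ∫⁻ ω in K m, f m ω ∂μ ≤ ∑' m, ENNReal.ofReal c₁ * v m :=
          ENNReal.tsum_le_tsum h1
      _ = ENNReal.ofReal c₁ * ∑' m, v m := ENNReal.tsum_mul_left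
      _ ≤ ENNReal.ofReal c₁ * (ENNReal.ofReal ((1 - ρ)⁻¹ * (γ₁ ^ θ * max a b)) * μ C) := by
          gcongr
      _ = ENNReal.ofReal (ε / M) * (2⁻¹ * μ C) := by
          have h2 : (2⁻¹ : ℝ≥0∞) = ENNReal.ofReal 2⁻¹ := by
            rw [ENNReal.ofReal_inv_of_pos two_pos]; simp
          have h3 : c₁ * ((1 - ρ)⁻¹ * (γ₁ ^ θ * max a b)) = ε / M * 2⁻¹ := by
            have : c₁ * (1 - ρ)⁻¹ * max a b = K₀ * (ε / M) := by rw [hK₀]; field_simp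
            calc _ = γ₁ ^ θ * (c₁ * (1 - ρ)⁻¹ * max a b) := by ring
              _ = _ := by rw [this, hγ₁θ]; field_simp
          rw [← mul_assoc, ← mul_assoc _ _ (μ C), ← ENNReal.ofReal_mul hc₁0.le, h3, h2,
            ← ENNReal.ofReal_mul (by positivity)]
  -- Markov's inequality. On the complement, x moves by less than ε/M in total as long as |φ(x)| ≤
  -- 2ε.
  have hMar : μ {ω | ENNReal.ofReal (ε / M) ≤ Z ω} ≤ 2⁻¹ * μ C := by
    have h1 := (mul_meas_ge_le_lintegral hZm (ENNReal.ofReal (ε / M))).trans hZint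
    exact (ENNReal.mul_le_mul_iff_right (by simp; positivity) ENNReal.ofReal_ne_top).1 h1
  have hsub : C ⊆ (C ∩ summableSteps X) ∪ {ω | ENNReal.ofReal (ε / M) ≤ Z ω} := by
    intro ω hω
    by_cases hZω : ENNReal.ofReal (ε / M) ≤ Z ω
    · exact Or.inr hZω
    refine Or.inl ⟨hω, ?_⟩
    rw [not_le] at hZω
    have hfin : ∀ m, (∀ i < m, ω ∈ K i) → ∑ i ∈ Finset.range m, f i ω ≤ Z ω := by
      intro m hm
      refine le_trans (le_of_eq (Finset.sum_congr rfl fun i hi => ?_))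
        (ENNReal.sum_le_tsum (Finset.range m))
      rw [indicator_of_mem (hm i (Finset.mem_range.1 hi))]
    -- A bootstrap: survival up to m bounds the displacement up to m + 1 by Z < ε/M, hence φ has
    -- changed by less than ε and |φ(x)| ≤ 2ε still holds at m + 1.
    have hall : ∀ m, (∀ i ≤ m, ω ∈ K i) ∧
        ENNReal.ofReal |(X (n + m) ω).1 - (X n ω).1| ≤ ∑ i ∈ Finset.range m, f i ω := by
      intro m
      induction m with
      | zero =>
        refine ⟨fun i hi => ?_, by simp⟩
        obtain rfl : i = 0 := by omega
        refine ⟨hω, fun j hj => ?_⟩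
        obtain rfl : j = 0 := by omega
        have := (hCB ω hω).1
        show |φ (X n ω).1| ≤ 2 * ε
        linarith
      | succ m ih =>
        obtain ⟨ih1, ih2⟩ := ih
        have hd' : ENNReal.ofReal |(X (n + (m + 1)) ω).1 - (X n ω).1| ≤
            ∑ i ∈ Finset.range (m + 1), f i ω := by
          rw [Finset.sum_range_succ]
          refine le_trans ?_ (add_le_add_left ih2 _)
          rw [hf, ← ENNReal.ofReal_add (abs_nonneg _)
            (mul_nonneg (hγ _ _).1.le (by positivity))]
          refine ENNReal.ofReal_le_ofReal ?_
          rw [← add_assoc, h.succ]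
          simp only [stepMap]
          set γ := (X (n + m) ω).2.1
          have hγ0 : 0 < γ := (hγ (n + m) ω).1
          set y := φ (X (n + m) ω).1 + E (n + m) ω
          have h1 : (X (n + m) ω).1 - γ * y - (X n ω).1 =
              ((X (n + m) ω).1 - (X n ω).1) - γ * y := by ring
          have h2 := abs_sub ((X (n + m) ω).1 - (X n ω).1) (γ * y)
          rw [abs_mul, abs_of_pos hγ0] at h2
          rw [h1]
          linarith
        have hlt := (hd'.trans (hfin (m + 1) fun i hi => ih1 i (by omega))).trans_lt hZω
        rw [ENNReal.ofReal_lt_ofReal_iff (by positivity), lt_div_iff₀ hM] at hlt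
        refine ⟨fun i hi => ?_, hd'⟩
        rcases Nat.lt_or_ge i (m + 1) with hlt' | hge
        · exact ih1 i (by omega)
        obtain rfl : i = m + 1 := by omega
        refine ⟨hω, fun j hj => ?_⟩
        rcases Nat.lt_or_ge j (m + 1) with hlt' | hge
        · exact (ih1 m le_rfl).2 j (by omega)
        obtain rfl : j = m + 1 := by omega
        have h3 := hLip (X (n + (m + 1)) ω).1 (X n ω).1
        have h4 := (hCB ω hω).1
        have h5 := abs_sub_abs_le_abs_sub (φ (X (n + (m + 1)) ω).1) (φ (X n ω).1)
        show |φ (X (n + (m + 1)) ω).1| ≤ 2 * ε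
        linarith
    refine tsum_ne_top_of_shift (fun n => ENNReal.ofReal_ne_top) n ?_
    refine ne_top_of_lt (lt_of_le_of_lt (ENNReal.tsum_le_tsum fun m => ?_) (hZω.trans
      ENNReal.ofReal_lt_top))
    rw [indicator_of_mem ((hall m).1 m le_rfl)]
    refine ENNReal.ofReal_le_ofReal (le_mul_of_one_le_right (hγ _ _).1.le ?_)
    linarith [abs_nonneg (φ (X (n + m) ω).1 + E (n + m) ω)]
  have h1 := (measure_mono hsub).trans (measure_union_le (μ := μ) _ _)
  have h2 : 2⁻¹ * μ C + 2⁻¹ * μ C ≤ μ (C ∩ summableSteps X) + 2⁻¹ * μ C := by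
    rw [← add_mul, ENNReal.inv_two_add_inv_two, one_mul]
    exact h1.trans (by gcongr)
  exact (ENNReal.add_le_add_iff_right
    (ENNReal.mul_ne_top (by simp) (measure_ne_top _ _))).1 h2

end SummableSteps

/-! ### Steering the process with errors of positive probability. -/

section Control

variable {Ω : Type*} {mΩ : MeasurableSpace Ω} {μ : Measure Ω}
  [IsProbabilityMeasure μ] {ν : Measure ℝ} {u d gbar : ℝ} {φ : ℝ → ℝ} {ℱ : Filtration ℕ mΩ}
  {X : ℕ → Ω → ℝ × ℝ × ℝ} {E : ℕ → Ω → ℝ}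

/-- Compactness in b: for b within η/3 of b₀, the interval contains the middle third of (b₀, b₀ +
η). The bound has to be uniform because the errors aimed at depend on φ(x). -/
theorem exists_pos_le_measure_Ioo {L η : ℝ} (hη : 0 < η)
    (hL : ∀ a b, -L ≤ a → a < b → b ≤ L → 0 < ν (Ioo a b)) :
    ∃ c : ℝ≥0∞, 0 < c ∧ ∀ b, -L ≤ b → b + η ≤ L → c ≤ ν (Ioo b (b + η)) := by
  obtain ⟨c, hc, h⟩ := (isCompact_Icc (a := -L) (b := L - η)).induction_on
    (p := fun s => ∃ c : ℝ≥0∞, 0 < c ∧ ∀ b ∈ s, c ≤ ν (Ioo b (b + η)))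
    ⟨1, one_pos, by simp⟩
    (fun s t hst ⟨c, hc, h⟩ => ⟨c, hc, fun b hb => h b (hst hb)⟩)
    (fun s t ⟨c, hc, h⟩ ⟨c', hc', h'⟩ => ⟨min c c', lt_min hc hc', fun b hb => hb.elim
      (fun hb => (min_le_left _ _).trans (h b hb)) fun hb => (min_le_right _ _).trans (h' b hb)⟩)
    (fun b₀ hb₀ => by
      refine ⟨Ioo (b₀ - η / 3) (b₀ + η / 3), mem_nhdsWithin_of_mem_nhds
        (Ioo_mem_nhds (by linarith) (by linarith)), ν (Ioo (b₀ + η / 3) (b₀ + 2 * η / 3)),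
        hL _ _ (by linarith [hb₀.1]) (by linarith) (by linarith [hb₀.2]), fun b hb => ?_⟩
      exact measure_mono (Ioo_subset_Ioo (by linarith [hb.2]) (by linarith [hb.1])))
  exact ⟨c, hc, fun b h1 h2 => h b ⟨h1, by linarith⟩⟩

theorem stepMap_γ_bounds (hd0 : 0 < d) (hd1 : d < 1) (hu : 1 < u) {s : ℝ × ℝ × ℝ}
    (hs : s.2.1 ∈ Ioc 0 gbar) (e : ℝ) :
    d * s.2.1 ≤ (stepMap u d gbar φ s e).2.1 ∧ (stepMap u d gbar φ s e).2.1 ≤ gbar := by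
  obtain ⟨h1, h2⟩ := hs
  have h3 : d * s.2.1 ≤ s.2.1 := by nlinarith
  simp only [stepMap]
  split_ifs
  · exact ⟨le_min (by nlinarith) (h3.trans h2), min_le_right _ _⟩
  · exact ⟨le_rfl, h3.trans h2⟩

/-- Errors which make the signs alternate bring down the step size while `x` hardly moves. -/
theorem exists_leadsTo_of_small_value (h : NoiseDriven μ ν (stepMap u d gbar φ) ℱ X E)
    (hφm : Measurable φ) (hd0 : 0 < d) (hd1 : d < 1) (hg : 0 < gbar)
    {M : ℝ} (hM : 0 < M) (hLip : ∀ a b, |φ a - φ b| ≤ M * |a - b|) {L : ℝ} (hL0 : 0 < L)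
    (hL : ∀ a b, -L ≤ a → a < b → b ≤ L → 0 < ν (Ioo a b)) {A : Set Ω} {c₀ : ℝ≥0∞}
    (hc₀ : 0 < c₀) {ε γ₁ : ℝ} (hε : 0 < ε) (hεL : ε ≤ L / 4) (hγ₁ : 0 < γ₁)
    (hlt : LeadsTo μ ℱ X A c₀ {s | |φ s.1| ≤ ε ∧ s.2.1 ≤ γ₁}) :
    ∃ c : ℝ≥0∞, 0 < c ∧
      LeadsTo μ ℱ X A c {s | |φ s.1| ≤ ε / 2 ∧ s.2.1 ∈ Ioc 0 gbar} := by
  obtain ⟨N, hN⟩ := exists_pow_lt_of_lt_one (div_pos hγ₁ hg) hd1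
  rw [lt_div_iff₀ hg] at hN
  -- N decreases bring γ from ḡ below γ₁. With |y| ≤ η each step changes φ by at most Mḡη, so N of
  -- them change it by at most ε/2.
  set η : ℝ := min (L / 2) (ε / (2 * M * gbar * (N + 1))) with hη
  have hη0 : 0 < η := lt_min (by linarith) (by positivity)
  have hηL : η ≤ L / 2 := min_le_left _ _
  have hηN : N * (M * gbar * η) ≤ ε / 2 := by
    have h1 : η ≤ ε / (2 * M * gbar * (N + 1)) := min_le_right _ _
    rw [le_div_iff₀ (by positivity)] at h1
    have : 0 < M * gbar * η := by positivity
    nlinarith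
  obtain ⟨c, hc, hcI⟩ := exists_pos_le_measure_Ioo hη0 hL
  -- States from which j more decreases suffice, with the corresponding allowance for the change of
  -- φ.
  set B : ℕ → Set (ℝ × ℝ × ℝ) := fun j =>
    {s | |φ s.1| ≤ ε - j * (M * gbar * η) ∧ s.2.1 ∈ Ioc 0 gbar ∧ d ^ j * s.2.1 ≤ γ₁} with hB
  have hBm : ∀ j, MeasurableSet (B j) := fun j => by
    refine MeasurableSet.inter ?_ (MeasurableSet.inter ?_ ?_)
    · exact measurableSet_le (hφm.comp measurable_fst).abs measurable_const
    · exact (measurable_fst.comp measurable_snd) measurableSet_Ioc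
    · exact measurableSet_le ((measurable_fst.comp measurable_snd).const_mul _) measurable_const
  have hstep : ∀ j, ∀ s ∈ B (j + 1), c ≤ ν {e | stepMap u d gbar φ s e ∈ B j} := by
    rintro j s ⟨h1, ⟨h2, h3⟩, h4⟩
    have hMη : 0 < M * gbar * η := by positivity
    have hj : (0 : ℝ) ≤ j := Nat.cast_nonneg j
    push_cast at h1
    have h1' : |φ s.1| ≤ L / 4 := by nlinarith
    rw [abs_le] at h1'
    have fin : ∀ e, |φ s.1 + e| ≤ η → ¬ 0 < s.2.2 * (φ s.1 + e) →
        stepMap u d gbar φ s e ∈ B j := by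
      intro e he hneg
      simp only [hB, stepMap, if_neg hneg, mem_ofPred_eq]
      refine ⟨?_, ⟨by positivity, by nlinarith⟩, ?_⟩
      · have h5 := hLip (s.1 - s.2.1 * (φ s.1 + e)) s.1
        rw [sub_sub_cancel_left, abs_neg, abs_mul, abs_of_pos h2] at h5
        have h6 : M * (s.2.1 * |φ s.1 + e|) ≤ M * gbar * η := by
          rw [mul_assoc]; gcongr
        have h7 := abs_sub_abs_le_abs_sub (φ (s.1 - s.2.1 * (φ s.1 + e))) (φ s.1)
        linarith
      · rw [← mul_assoc, ← pow_succ]; exact h4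
    -- The error is taken from a window of length η next to -φ(x), on the side where the new
    -- observation does not agree in sign with the last.
    by_cases hy : 0 < s.2.2
    · refine (hcI (-φ s.1 - η) (by linarith) (by linarith)).trans (measure_mono fun e he => ?_)
      have h5 : -η < φ s.1 + e := by linarith [he.1]
      have h6 : φ s.1 + e < 0 := by linarith [he.2]
      refine fin e (abs_le.2 ⟨h5.le, by linarith⟩) ?_
      nlinarith
    · refine (hcI (-φ s.1) (by linarith) (by linarith)).trans (measure_mono fun e he => ?_)
      have h5 : 0 < φ s.1 + e := by linarith [he.1]
      have h6 : φ s.1 + e < η := by linarith [he.2]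
      refine fin e (abs_le.2 ⟨by linarith, h6.le⟩) ?_
      nlinarith
  have hall : ∀ j, LeadsTo μ ℱ X A (c₀ * c ^ j) (B j) := by
    intro j
    induction j with
    | zero =>
      refine hlt.mono (by simp) ?_
      rintro s ⟨h1, -, h3⟩
      simp only [Nat.cast_zero, zero_mul, sub_zero, pow_zero, one_mul] at h1 h3
      exact ⟨h1, h3⟩
    | succ j ih =>
      rw [pow_succ, ← mul_assoc]
      exact ih.step h (hBm j) (hstep j)
  refine ⟨c₀ * c ^ N, by positivity, (hall N).mono le_rfl ?_⟩
  rintro s ⟨h1, h2⟩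
  refine ⟨by linarith, h2, ?_⟩
  have := mul_le_mul_of_nonneg_left h2.2 (pow_pos hd0 N).le
  linarith

theorem mul_add_pos_of_abs_lt {w e : ℝ} (h : |e| < |w|) : 0 < w * (w + e) := by
  rcases lt_trichotomy w 0 with hw | rfl | hw
  · rw [abs_of_neg hw] at h
    exact mul_pos_of_neg_of_neg hw (by linarith [le_abs_self e])
  · simp only [abs_zero] at h
    exact absurd h (not_lt.2 (abs_nonneg e))
  · rw [abs_of_pos hw] at h
    exact mul_pos hw (by linarith [neg_abs_le e])

theorem mul_add_pos_of_abs_le {w e z : ℝ} (hw : w ≠ 0) (hz : z < 1) (h : |e| ≤ z * |w|) :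
    0 < w * (w + e) := by
  refine mul_add_pos_of_abs_lt (h.trans_lt ?_)
  have := abs_pos.2 hw
  nlinarith

/-- For w = φ(x), error e and c = Mγ/2, the right side times γ is the guaranteed decrease of Φ. With
z = (1 - m)/8 the error costs at most 4z of the factor 1 - m = 8z, which leaves half of it. -/
theorem descent_amount {w e m c : ℝ} (hm0 : 0 < m) (hm1 : m < 1) (hc : c ≤ m)
    (h : |e| ≤ (1 - m) / 8 * |w|) :
    (1 - m) / 2 * w ^ 2 ≤ w * (w + e) - c * (w + e) ^ 2 := by
  set z := (1 - m) / 8 with hz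
  have hz0 : 0 < z := by rw [hz]; linarith
  have hz1 : z < 1 / 8 := by rw [hz]; linarith
  have h1 : |w * e| ≤ z * w ^ 2 := by
    rw [abs_mul, ← sq_abs w, sq, ← mul_assoc, mul_comm |w|]
    gcongr
  have h2 : |w + e| ≤ (1 + z) * |w| := by linarith [abs_add_le w e]
  have h3 : (w + e) ^ 2 ≤ (1 + z) ^ 2 * w ^ 2 := by
    rw [← sq_abs (w + e), ← sq_abs w, ← mul_pow]
    gcongr
  have h4 : c * (w + e) ^ 2 ≤ m * ((1 + z) ^ 2 * w ^ 2) :=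
    (mul_le_mul_of_nonneg_right hc (sq_nonneg _)).trans (mul_le_mul_of_nonneg_left h3 hm0.le)
  have h5 : (1 - m) / 2 ≤ 1 - z - m * (1 + z) ^ 2 := by
    have h6 : m * (2 * z + z ^ 2) ≤ 1 * (3 * z) := by
      gcongr
      nlinarith
    have h7 : m * (1 + z) ^ 2 = m + m * (2 * z + z ^ 2) := by ring
    linarith
  have h8 := mul_le_mul_of_nonneg_right h5 (sq_nonneg w)
  have h9 := (abs_le.1 h1).1
  linarith

/-- Small errors bring `x`, by descent, to a place where `|φ x|` is small. -/
theorem exists_leadsTo_of_bounded (h : NoiseDriven μ ν (stepMap u d gbar φ) ℱ X E)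
    (hφ : Continuous φ) (hd0 : 0 < d) (hd1 : d < 1) (hu : 1 < u) (hg : 0 < gbar)
    {M : ℝ} (hM : 0 < M) (hLip : ∀ a b, |φ a - φ b| ≤ M * |a - b|) (hgM : gbar * M < 2)
    {Φ : ℝ → ℝ} (hΦc : Continuous Φ)
    (hΦ : ∀ x h, Φ (x + h) ≤ Φ x + φ x * h + M / 2 * h ^ 2) (hΦ0 : ∀ x, 0 ≤ Φ x)
    {L : ℝ} (hL0 : 0 < L) (hL : ∀ a b, -L ≤ a → a < b → b ≤ L → 0 < ν (Ioo a b)) {A : Set Ω}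
    {c₀ : ℝ≥0∞} (hc₀ : 0 < c₀) {ε γ₀ R : ℝ} (hε : 0 < ε) (hγ₀ : 0 < γ₀)
    (hlt : LeadsTo μ ℱ X A c₀ {s | |φ s.1| ≤ ε ∧ s.2.1 ∈ Ioc 0 gbar}) :
    ∃ c : ℝ≥0∞, 0 < c ∧
      LeadsTo μ ℱ X A c {s | |s.1| ≤ R ∧ γ₀ ≤ s.2.1 ∧ s.2.1 ≤ gbar} := by
  have := h.isProbabilityMeasure
  set m : ℝ := M * gbar / 2 with hm
  have hm0 : 0 < m := by positivity
  have hm1 : m < 1 := by rw [hm]; linarith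
  set z : ℝ := (1 - m) / 8 with hz
  have hz0 : 0 < z := by rw [hz]; linarith
  -- A lower bound that γ keeps during the descent: the first term makes the initial γ at least
  -- γl/d, the second makes dγ ≥ γl/d whenever γ ≥ 1/(2M).
  set γl : ℝ := min (d * γ₀) (d ^ 2 / (2 * M)) with hγl
  have hγl0 : 0 < γl := lt_min (by positivity) (by positivity)
  have hγl1 : γl / d ≤ γ₀ := by
    rw [div_le_iff₀ hd0, mul_comm]; exact min_le_left _ _
  have hγl2 : γl / d ≤ d / (2 * M) := by
    rw [div_le_iff₀ hd0]
    exact (min_le_right _ _).trans (le_of_eq (by ring))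
  set Δ : ℝ := γl * ((1 - m) / 2 * ε ^ 2) with hΔ
  have hΔ0 : 0 < Δ := by
    have : 0 < 1 - m := by linarith
    positivity
  -- The middle condition keeps γ ≥ γl: either one decrease is affordable, or the last observation
  -- has the sign of φ(x), so that a small error yields agreement and γ does not fall below γl.
  set B : ℕ → Set (ℝ × ℝ × ℝ) := fun N => {s | (γl ≤ s.2.1 ∧ s.2.1 ≤ gbar) ∧
    (γl / d ≤ s.2.1 ∨ 0 < φ s.1 * s.2.2) ∧ Φ s.1 < N * Δ} with hB
  have hφm := hφ.measurable
  have hBm : ∀ N, MeasurableSet (B N) := fun N => by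
    refine MeasurableSet.inter ?_ (MeasurableSet.inter (MeasurableSet.union ?_ ?_) ?_)
    · exact (measurable_fst.comp measurable_snd) measurableSet_Icc
    · exact measurableSet_le measurable_const (measurable_fst.comp measurable_snd)
    · exact measurableSet_lt measurable_const
        ((hφm.comp measurable_fst).mul (measurable_snd.comp measurable_snd))
    · exact measurableSet_lt (hΦc.measurable.comp measurable_fst) measurable_const
  set η : ℝ := min (z * ε) L with hη
  have hη0 : 0 < η := lt_min (by positivity) hL0
  set c : ℝ≥0∞ := ν (Ioo (-η) η) with hc
  have hc0 : 0 < c := hL _ _ (neg_le_neg (min_le_right _ _)) (by linarith) (min_le_right _ _)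
  have hstep : ∀ N, ∀ s ∈ B (N + 1) ∩ {s | ε < |φ s.1|},
      c ≤ ν {e | stepMap u d gbar φ s e ∈ B N} := by
    rintro N s ⟨⟨⟨h1, h2⟩, h3, h4⟩, h5 : ε < |φ s.1|⟩
    refine measure_mono fun e he => ?_
    have hγ0 : 0 < s.2.1 := hγl0.trans_le h1
    have he' : |e| ≤ z * |φ s.1| := by
      refine (abs_le.2 ⟨he.1.le, he.2.le⟩).trans ((min_le_left _ _).trans ?_)
      gcongr
    set γ := s.2.1
    set w := φ s.1
    obtain ⟨hb1, hb2⟩ := stepMap_γ_bounds (φ := φ) hd0 hd1 hu (s := s) ⟨hγ0, h2⟩ e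
    have hw0 : 0 < |w| := hε.trans h5
    have hw2 : ε ^ 2 ≤ w ^ 2 := by rw [← sq_abs w]; gcongr
    have hw2' : 0 < w ^ 2 := lt_of_lt_of_le (by positivity) hw2
    have hz1 : z < 1 / 8 := by rw [hz]; linarith
    have hwy : 0 < w * (w + e) := mul_add_pos_of_abs_le (abs_pos.1 hw0) (by linarith) he'
    refine ⟨⟨?_, hb2⟩, ?_, ?_⟩
    · rcases h3 with h3 | h3
      · refine le_trans ?_ hb1
        rw [div_le_iff₀ hd0] at h3
        linarith
      · have hyy : 0 < s.2.2 * (w + e) := by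
          have : 0 < (w * s.2.2) * (w * (w + e)) := mul_pos h3 hwy
          have h6 : (w * s.2.2) * (w * (w + e)) = w ^ 2 * (s.2.2 * (w + e)) := by ring
          rw [h6] at this
          exact pos_of_mul_pos_right this hw2'.le
        have : (stepMap u d gbar φ s e).2.1 = min (u * γ) gbar := if_pos hyy
        rw [this]
        exact le_min (h1.trans (by nlinarith)) (h1.trans h2)
    -- A large γ stays above γl/d after one decrease; a small γ moves x so little that φ keeps its
    -- sign, which is also the sign of the new observation.
    · rcases le_or_gt (1 / (2 * M)) γ with h6 | h6
      · left
        refine hγl2.trans (le_trans ?_ hb1)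
        calc d / (2 * M) = d * (1 / (2 * M)) := by ring
          _ ≤ d * γ := by gcongr
      · right
        have h7 := hLip (s.1 - γ * (w + e)) s.1
        rw [sub_sub_cancel_left, abs_neg, abs_mul, abs_of_pos hγ0, ← mul_assoc] at h7
        rw [lt_div_iff₀ (by positivity)] at h6
        have h9 : |φ (s.1 - γ * (w + e)) - w| < |w| := by
          refine h7.trans_lt ?_
          have h10 : |w + e| ≤ (1 + z) * |w| := by
            have := abs_add_le w e
            linarith
          have hMγ : M * γ < 1 / 2 := by linarith
          have hMγ0 : 0 < M * γ := by positivity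
          calc M * γ * |w + e| ≤ M * γ * ((1 + z) * |w|) := by gcongr
            _ ≤ 1 / 2 * ((1 + z) * |w|) := by gcongr
            _ < |w| := by
              have : z * |w| < 1 / 8 * |w| := by gcongr
              linarith
        have h11 : 0 < φ (s.1 - γ * (w + e)) * w := by
          have h14 := mul_add_pos_of_abs_lt h9
          rw [add_sub_cancel] at h14
          rwa [mul_comm]
        have h12 : 0 < (φ (s.1 - γ * (w + e)) * w) * (w * (w + e)) := mul_pos h11 hwy
        have h13 : (φ (s.1 - γ * (w + e)) * w) * (w * (w + e)) =
            w ^ 2 * (φ (s.1 - γ * (w + e)) * (w + e)) := by ring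
        rw [h13] at h12
        exact pos_of_mul_pos_right h12 hw2'.le
    · have h6 := hΦ s.1 (-(γ * (w + e)))
      have h7 : (stepMap u d gbar φ s e).1 = s.1 + -(γ * (w + e)) := sub_eq_add_neg _ _
      rw [h7]
      push_cast at h4
      have hbr : (1 - m) / 2 * w ^ 2 ≤ w * (w + e) - M / 2 * γ * (w + e) ^ 2 := by
        have h8 : M / 2 * γ ≤ m := by
          calc M / 2 * γ ≤ M / 2 * gbar := by gcongr
            _ = m := by rw [hm]; ring
        exact descent_amount hm0 hm1 h8 he'
      have hdec : Δ ≤ γ * (w * (w + e) - M / 2 * γ * (w + e) ^ 2) := by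
        have h1m : 0 < 1 - m := by linarith
        calc Δ ≤ γ * ((1 - m) / 2 * w ^ 2) := by rw [hΔ]; gcongr
          _ ≤ _ := by gcongr
      have h11 : γ * (w * (w + e) - M / 2 * γ * (w + e) ^ 2) =
          -(w * -(γ * (w + e)) + M / 2 * (-(γ * (w + e))) ^ 2) := by ring
      rw [h11] at hdec
      linarith
  have hc1 : c ≤ 1 := prob_le_one
  have hall : ∀ N, LeadsTo μ ℱ X A (c₀ * c ^ N) (B N) := by
    intro N
    induction N with
    | zero =>
      -- No state satisfies Φ < 0, so there is nothing to prove when the potential is used up.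
      intro n C _ hCB
      have : C = ∅ := eq_empty_of_forall_notMem fun ω hω => by
        have := (hCB ω hω).2.2
        rw [Nat.cast_zero, zero_mul] at this
        exact absurd (hΦ0 _) (not_le.2 this)
      simp [this]
    | succ N ih =>
      have h1 : LeadsTo μ ℱ X A (c₀ * c ^ (N + 1)) (B (N + 1) ∩ {s | ε < |φ s.1|}) := by
        rw [pow_succ, ← mul_assoc]
        exact ih.step h (hBm N) (hstep N)
      have h2 : LeadsTo μ ℱ X A (c₀ * c ^ (N + 1)) {s | |φ s.1| ≤ ε ∧ s.2.1 ∈ Ioc 0 gbar} :=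
        hlt.mono (mul_le_of_le_one_right' (pow_le_one₀ zero_le hc1)) subset_rfl
      refine (LeadsTo.union h.adapted ?_ h2 h1).mono le_rfl ?_
      · refine MeasurableSet.inter ?_ ?_
        · exact measurableSet_le (hφm.comp measurable_fst).abs measurable_const
        · exact (measurable_fst.comp measurable_snd) measurableSet_Ioc
      · intro s hs
        rcases le_or_gt |φ s.1| ε with h3 | h3
        · exact Or.inl ⟨h3, hγl0.trans_le hs.1.1, hs.1.2⟩
        · exact Or.inr ⟨hs, h3⟩
  obtain ⟨b, hb⟩ := (isCompact_Icc (a := -R) (b := R)).bddAbove_image hΦc.continuousOn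
  obtain ⟨N, hN⟩ := exists_nat_gt (b / Δ)
  rw [div_lt_iff₀ hΔ0] at hN
  refine ⟨c₀ * c ^ N, by positivity, (hall N).mono le_rfl ?_⟩
  rintro s ⟨h1, h2, h3⟩
  refine ⟨⟨?_, h3⟩, Or.inl (hγl1.trans h2), ?_⟩
  · refine le_trans ?_ (hγl1.trans h2)
    rw [le_div_iff₀ hd0]; nlinarith
  · exact (hb (mem_image_of_mem Φ (abs_le.1 h1))).trans_lt hN

end Control

/-! ### Almost sure summability of the steps in the subcritical case. -/

section Convergence

variable {Ω : Type*} {mΩ : MeasurableSpace Ω} {μ : Measure Ω}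
  [IsProbabilityMeasure μ] {ν : Measure ℝ} {u d gbar : ℝ} {φ : ℝ → ℝ} {ℱ : Filtration ℕ mΩ}
  {X : ℕ → Ω → ℝ × ℝ × ℝ} {E : ℕ → Ω → ℝ}

/-- Continuity from above. The sign of w + ξ can differ from that of ξ only for |ξ| ≤ |w|, so a
small w changes the sign probabilities little. -/
theorem exists_measure_closedBall_le [IsFiniteMeasure ν] (h0 : ν {0} = 0) {η : ℝ} (hη : 0 < η) :
    ∀ᶠ t in 𝓝[>] (0 : ℝ), ν (Metric.closedBall 0 t) ≤ ENNReal.ofReal η := by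
  have h1 := tendsto_measure_cthickening_of_isClosed (μ := ν) (s := {(0 : ℝ)})
    ⟨1, one_pos, measure_ne_top _ _⟩ isClosed_singleton
  rw [h0] at h1
  have h2 := (h1.mono_left nhdsWithin_le_nhds : Tendsto _ (𝓝[>] (0 : ℝ)) _).eventually_lt_const
    (ENNReal.ofReal_pos.2 hη)
  filter_upwards [h2, self_mem_nhdsWithin] with t ht (ht0 : 0 < t)
  rw [Metric.cthickening_singleton _ ht0.le] at ht
  exact ht.le

/-- If errors agree in sign with probability below the critical ratio, the step sizes are almost
surely summable. -/
theorem ae_mem_summableSteps (h : NoiseDriven μ ν (stepMap u d gbar φ) ℱ X E)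
    (hφ : Continuous φ) (hγ : ∀ n ω, (X n ω).2.1 ∈ Ioc 0 gbar)
    (hd0 : 0 < d) (hd1 : d < 1) (hu : 1 < u) (hg : 0 < gbar)
    {M : ℝ} (hM : 0 < M) (hLip : ∀ a b, |φ a - φ b| ≤ M * |a - b|) (hgM : gbar * M < 2)
    {Φ : ℝ → ℝ} (hΦc : Continuous Φ)
    (hΦ : ∀ x h, Φ (x + h) ≤ Φ x + φ x * h + M / 2 * h ^ 2) (hΦ0 : ∀ x, 0 ≤ Φ x)
    {L : ℝ} (hL0 : 0 < L) (hL : ∀ a b, -L ≤ a → a < b → b ≤ L → 0 < ν (Ioo a b))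
    (hν0 : ν {0} = 0) {S : ℝ} (hi1 : Integrable (fun e => e) ν)
    (hi2 : Integrable (fun e => e ^ 2) ν) (hm : ∫ e, e ∂ν = 0) (hS : ∫ e, e ^ 2 ∂ν = S)
    {R c₀ : ℝ} (hR : ∀ x, R ≤ |x| → c₀ ≤ φ x ^ 2) (hc₀ : gbar * M * S / (2 - gbar * M) < c₀)
    (hk : ν.real (Ioi 0) ^ 2 + ν.real (Iio 0) ^ 2 < critRatio u d) :
    ∀ᵐ ω ∂μ, ω ∈ summableSteps X := by
  have hprob := h.isProbabilityMeasure
  have hS0 : 0 ≤ S := hS ▸ integral_nonneg fun e => sq_nonneg e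
  set p := ν.real (Ioi 0) with hp
  set q := ν.real (Iio 0) with hq
  have hIic : ν (Iic 0) = ν (Iio 0) := by
    refine le_antisymm ?_ (measure_mono Iio_subset_Iic_self)
    rw [← Iio_union_right]
    exact (measure_union_le _ _).trans (by rw [hν0, add_zero])
  have hpq : p + q = 1 := by
    have h1 := probReal_add_probReal_compl (μ := ν) (measurableSet_Ioi (a := (0 : ℝ)))
    rw [compl_Ioi] at h1
    rw [hp, hq, ← h1, Measure.real, Measure.real, Measure.real, hIic]
  obtain ⟨θ, a, b, ρ, η, hθ0, hθ1, ha, hb, hρ0, hρ1, hη, hw1, hw2⟩ :=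
    exists_decay_weights hd0 hd1 hu hpq hk
  obtain ⟨t, ht1, ht2, ht3 : 0 < t⟩ := ((exists_measure_closedBall_le hν0 hη).and
    (((eventually_le_nhds (show (0 : ℝ) < L / 2 by linarith)).filter_mono nhdsWithin_le_nhds).and
      self_mem_nhdsWithin)).exists
  set ε := t / 2 with hε
  have hε0 : 0 < ε := by rw [hε]; linarith
  have hεt : 2 * ε = t := by rw [hε]; ring
  have hp0 : 0 ≤ p := measureReal_nonneg
  have hq0 : 0 ≤ q := measureReal_nonneg
  have hcon : ∀ s : ℝ × ℝ × ℝ, 0 < s.2.1 → s.2.1 ≤ gbar → |φ s.1| ≤ 2 * ε →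
      ∫⁻ e, ENNReal.ofReal ((stepMap u d gbar φ s e).2.1 ^ θ *
        if 0 < (stepMap u d gbar φ s e).2.2 then a else b) ∂ν ≤
      ENNReal.ofReal ρ * ENNReal.ofReal (s.2.1 ^ θ * if 0 < s.2.2 then a else b) := by
    intro s hs1 hs2 hs3
    rw [hεt, abs_le] at hs3
    refine lintegral_decay_step_le hd0 hd1 hu hθ0 ha hb hρ0 (by linarith) (by linarith) hw1 hw2
      hs1 hs2 ?_ ?_
    · rw [ENNReal.ofReal_add hp0 hη.le, hp, ofReal_measureReal]
      refine (measure_mono ?_).trans ((measure_union_le (Ioi 0) (Metric.closedBall 0 t)).trans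
        (by gcongr))
      intro e (he : 0 < φ s.1 + e)
      rw [Real.closedBall_eq_Icc]
      rcases lt_or_ge 0 e with h1 | h1
      · exact Or.inl h1
      · exact Or.inr ⟨by linarith, by linarith⟩
    · rw [ENNReal.ofReal_add hq0 hη.le, hq, ofReal_measureReal]
      refine (measure_mono ?_).trans ((measure_union_le (Iio 0) (Metric.closedBall 0 t)).trans
        (by gcongr))
      intro e (he : ¬ 0 < φ s.1 + e)
      rw [Real.closedBall_eq_Icc]
      rcases lt_or_ge e 0 with h1 | h1
      · exact Or.inl h1
      · exact Or.inr ⟨by linarith, by linarith⟩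
  obtain ⟨γ₁, hγ₁, hlt1⟩ := exists_leadsTo_of_contraction h hφ.measurable hγ hM hLip hi1 hθ0 hθ1
    ha hb hρ0 hρ1 hε0 hcon
  obtain ⟨c₂, hc₂, hlt2⟩ := exists_leadsTo_of_small_value h hφ.measurable hd0 hd1 hg hM hLip hL0 hL
    (by simp) hε0 (by linarith) hγ₁ hlt1
  set m : ℝ := M * gbar / 2 with hmdef
  have hm1 : m < 1 := by rw [hmdef]; linarith
  -- The second term keeps the noise contribution MγS/2 below (1 - m)ε²/2, half of the decrease
  -- guaranteed when |φ(x)| > ε.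
  set γ₀ : ℝ := min γ₁ ((1 - m) * ε ^ 2 / (M * S + 1)) with hγ₀
  have h1m : 0 < 1 - m := by linarith
  have hγ₀0 : 0 < γ₀ := lt_min hγ₁ (by positivity)
  obtain ⟨c₃, hc₃, hlt3⟩ := exists_leadsTo_of_bounded h hφ hd0 hd1 hu hg hM hLip hgM hΦc hΦ hΦ0
    hL0 hL hc₂ (half_pos hε0) hγ₀0 (R := R) hlt2
  set B₁ : Set (ℝ × ℝ × ℝ) := {s | |φ s.1| ≤ ε ∧ s.2.1 ≤ γ₀} with hB₁
  set B₂ : Set (ℝ × ℝ × ℝ) := {s | |s.1| ≤ R ∧ γ₀ ≤ s.2.1 ∧ s.2.1 ≤ gbar} with hB₂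
  have hB₁m : MeasurableSet B₁ := by
    refine MeasurableSet.inter ?_ ?_
    · exact measurableSet_le (hφ.measurable.comp measurable_fst).abs measurable_const
    · exact measurableSet_le (measurable_fst.comp measurable_snd) measurable_const
  have hB₂m : MeasurableSet B₂ := by
    refine MeasurableSet.inter ?_ ?_
    · exact measurableSet_le measurable_fst.abs measurable_const
    · exact (measurable_fst.comp measurable_snd) measurableSet_Icc
  have hltB : LeadsTo μ ℱ X (summableSteps X) (min 2⁻¹ c₃) (B₁ ∪ B₂) :=
    LeadsTo.union h.adapted hB₁m
      (hlt1.mono (min_le_left _ _) fun s hs => ⟨hs.1, hs.2.trans (min_le_left _ _)⟩)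
      (hlt3.mono (min_le_right _ _) subset_rfl)
  refine hltB.ae_mem h.adapted (measurableSet_summableSteps h.adapted)
    (lt_min (by simp) hc₃) (hB₁m.union hB₂m) ?_
  -- One term for each region outside B₁ ∪ B₂: small steps with |φ(x)| > ε, and |x| > R, where `A6`
  -- gives (1 - m)c₀ > mS.
  set δ : ℝ := min ((1 - m) * ε ^ 2 / 2) ((1 - m) * c₀ - m * S) with hδ
  have hc₀' : 0 < (1 - m) * c₀ - m * S := by
    rw [div_lt_iff₀ (by linarith)] at hc₀
    rw [hmdef]; linarith
  have hδ0 : 0 < δ := lt_min (by positivity) hc₀'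
  refine ae_frequently_mem h hΦc.measurable hδ0 (hB₁m.union hB₂m) fun n ω hn => ?_
  obtain ⟨hg1, hg2⟩ := hγ n ω
  set s := X n ω
  have hdrift : δ ≤ (1 - M / 2 * s.2.1) * φ s.1 ^ 2 - M / 2 * s.2.1 * S := by
    have h1 : M / 2 * s.2.1 ≤ m := by
      calc M / 2 * s.2.1 ≤ M / 2 * gbar := by gcongr
        _ = m := by rw [hmdef]; ring
    have h2 : (1 - m) * φ s.1 ^ 2 ≤ (1 - M / 2 * s.2.1) * φ s.1 ^ 2 := by gcongr
    rcases le_or_gt |s.1| R with h3 | h3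
    · have h4 : s.2.1 < γ₀ := by
        by_contra hcon
        exact hn (Or.inr ⟨h3, not_lt.1 hcon, hg2⟩)
      have h5 : ε < |φ s.1| := by
        by_contra hcon
        exact hn (Or.inl ⟨not_lt.1 hcon, h4.le⟩)
      have h6 : ε ^ 2 ≤ φ s.1 ^ 2 := by rw [← sq_abs (φ s.1)]; gcongr
      have h7 : s.2.1 ≤ (1 - m) * ε ^ 2 / (M * S + 1) := h4.le.trans (min_le_right _ _)
      rw [le_div_iff₀ (by positivity)] at h7
      have h8 : (1 - m) * ε ^ 2 ≤ (1 - m) * φ s.1 ^ 2 := by gcongr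
      have h9 : δ ≤ (1 - m) * ε ^ 2 / 2 := min_le_left _ _
      linarith
    · have h4 : (1 - m) * c₀ ≤ (1 - m) * φ s.1 ^ 2 := by
        gcongr
        exact hR _ h3.le
      have h5 : M / 2 * s.2.1 * S ≤ m * S := by gcongr
      have h9 : δ ≤ (1 - m) * c₀ - m * S := min_le_right _ _
      linarith
  have hstep := lintegral_potential_step_le (u := u) (d := d) (gbar := gbar) hΦ hΦ0 hi1 hi2 hm hS s
  refine (add_le_add_left (hstep.trans (ENNReal.ofReal_le_ofReal (q := Φ s.1 - s.2.1 * δ) ?_))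
    _).trans ?_
  · gcongr
  · rw [← ENNReal.ofReal_mul hδ0.le, mul_comm δ]
    -- Truncation by `ENNReal.ofReal` would spoil the estimate if Φ(x) < γδ. A noiseless step
    -- excludes this: its result has Φ ≥ 0, so Φ(x) is at least the guaranteed decrease.
    by_cases hneg : 0 ≤ Φ s.1 - s.2.1 * δ
    · rw [← ENNReal.ofReal_add hneg (by positivity), sub_add_cancel]
    · exfalso
      rw [not_le] at hneg
      have hcontra : ∀ e, Φ s.1 + φ s.1 * e + M / 2 * e ^ 2 ≥ 0 := fun e =>
        (hΦ0 _).trans (hΦ s.1 e)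
      have h1 := hcontra (-(s.2.1 * φ s.1))
      have h2 : 0 ≤ M / 2 * s.2.1 * S := by positivity
      nlinarith

end Convergence

/-! ### Summable steps imply convergence. -/

section Pathwise

/-- A perturbed recursion with summable steps and summable perturbations converges. -/
theorem exists_tendsto_of_summable {φ : ℝ → ℝ} {M : ℝ} (hM : 0 ≤ M)
    (hLip : ∀ a b, |φ a - φ b| ≤ M * |a - b|) {x γ e : ℕ → ℝ} (hγ : ∀ n, 0 ≤ γ n)
    (hx : ∀ n, x (n + 1) = x n - γ n * (φ (x n) + e n)) (h1 : Summable γ)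
    (h2 : Summable fun n => γ n * |e n|) : ∃ p, Tendsto x atTop (𝓝 p) := by
  have hφb : ∀ a, |φ a| ≤ |φ 0| + M * |a| := by
    intro a
    have := hLip a 0
    rw [sub_zero] at this
    linarith [abs_sub_abs_le_abs_sub (φ a) (φ 0)]
  set w : ℕ → ℝ := fun n => γ n * |φ 0| + γ n * |e n| with hw
  have hws : Summable w := (h1.mul_right _).add h2
  have hw0 : ∀ n, 0 ≤ w n := fun n =>
    add_nonneg (mul_nonneg (hγ n) (abs_nonneg _)) (mul_nonneg (hγ n) (abs_nonneg _))
  have hstep : ∀ n, |x (n + 1) - x n| ≤ M * γ n * |x n| + w n := by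
    intro n
    have h3 : x (n + 1) - x n = -(γ n * (φ (x n) + e n)) := by rw [hx]; ring
    rw [h3, abs_neg, abs_mul, abs_of_nonneg (hγ n)]
    have h4 : |φ (x n) + e n| ≤ |φ 0| + M * |x n| + |e n| :=
      (abs_add_le _ _).trans (by linarith [hφb (x n)])
    have := mul_le_mul_of_nonneg_left h4 (hγ n)
    simp only [hw]
    linarith
  -- Discrete Gronwall inequality, from the linear growth of φ. Once x is bounded, its increments
  -- are summable.
  have hbound : ∀ n, |x n| ≤ Real.exp (M * ∑ i ∈ Finset.range n, γ i) *
      (|x 0| + ∑ i ∈ Finset.range n, w i) := by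
    intro n
    induction n with
    | zero => simp
    | succ n ih =>
      have hs0 : 0 ≤ ∑ i ∈ Finset.range n, γ i := Finset.sum_nonneg fun i _ => hγ i
      have hs0' : 0 ≤ ∑ i ∈ Finset.range (n + 1), γ i := Finset.sum_nonneg fun i _ => hγ i
      have h3 : |x (n + 1)| ≤ (1 + M * γ n) * |x n| + w n := by
        have := abs_sub_abs_le_abs_sub (x (n + 1)) (x n)
        linarith [hstep n]
      have h4 : 1 + M * γ n ≤ Real.exp (M * γ n) := by linarith [Real.add_one_le_exp (M * γ n)]
      have h5 : Real.exp (M * ∑ i ∈ Finset.range (n + 1), γ i) =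
          Real.exp (M * γ n) * Real.exp (M * ∑ i ∈ Finset.range n, γ i) := by
        rw [Finset.sum_range_succ, ← Real.exp_add]; congr 1; ring
      have h6 : w n ≤ Real.exp (M * ∑ i ∈ Finset.range (n + 1), γ i) * w n :=
        le_mul_of_one_le_left (hw0 n) (Real.one_le_exp (by positivity))
      calc |x (n + 1)| ≤ (1 + M * γ n) * |x n| + w n := h3
        _ ≤ Real.exp (M * γ n) * (Real.exp (M * ∑ i ∈ Finset.range n, γ i) *
              (|x 0| + ∑ i ∈ Finset.range n, w i)) +
            Real.exp (M * ∑ i ∈ Finset.range (n + 1), γ i) * w n := by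
            gcongr
        _ = _ := by rw [h5, Finset.sum_range_succ w]; ring
  set b : ℝ := Real.exp (M * ∑' i, γ i) * (|x 0| + ∑' i, w i) with hb
  have hxb : ∀ n, |x n| ≤ b := by
    intro n
    refine (hbound n).trans ?_
    have h3 := h1.sum_le_tsum (Finset.range n) fun i _ => hγ i
    have h4 := hws.sum_le_tsum (Finset.range n) fun i _ => hw0 i
    have h5 : 0 ≤ ∑ i ∈ Finset.range n, w i := Finset.sum_nonneg fun i _ => hw0 i
    rw [hb]
    gcongr
  have hsum : Summable fun n => dist (x n) (x n.succ) := by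
    refine Summable.of_nonneg_of_le (fun n => dist_nonneg) (fun n => ?_)
      ((h1.mul_left (M * b)).add hws)
    rw [dist_comm, Real.dist_eq]
    refine (hstep n).trans ?_
    have : M * γ n * |x n| ≤ M * γ n * b :=
      mul_le_mul_of_nonneg_left (hxb n) (mul_nonneg hM (hγ n))
    linarith
  exact cauchySeq_tendsto_of_complete (cauchySeq_of_summable_dist hsum)

variable {Ω : Type*} {mΩ : MeasurableSpace Ω} {μ : Measure Ω}
  [IsProbabilityMeasure μ] {ν : Measure ℝ} {u d gbar : ℝ} {φ : ℝ → ℝ} {ℱ : Filtration ℕ mΩ}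
  {X : ℕ → Ω → ℝ × ℝ × ℝ} {E : ℕ → Ω → ℝ}

/-- If the step sizes are summable then so are, almost surely, the errors multiplied by them. -/
theorem ae_tsum_noise_ne_top (h : NoiseDriven μ ν (stepMap u d gbar φ) ℱ X E)
    (hi1 : Integrable (fun e => e) ν) :
    ∀ᵐ ω ∂μ, ω ∈ summableSteps X →
      ∑' n, ENNReal.ofReal (X n ω).2.1 * ENNReal.ofReal |E n ω| ≠ ∞ := by
  have hγm : ∀ n, Measurable[ℱ n] fun ω => ENNReal.ofReal (X n ω).2.1 := fun n =>
    (measurable_fst.comp (measurable_snd.comp (h.adapted n))).ennreal_ofReal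
  have hγm' : ∀ n, Measurable fun ω => ENNReal.ofReal (X n ω).2.1 := fun n =>
    (hγm n).mono (ℱ.le n) le_rfl
  have key : ∀ N : ℕ, ∀ᵐ ω ∂μ, ∑' n, ENNReal.ofReal (X n ω).2.1 ≤ N →
      ∑' n, ENNReal.ofReal (X n ω).2.1 * ENNReal.ofReal |E n ω| ≠ ∞ := by
    intro N
    -- Stopping before the step sum exceeds N. The step at index m is ℱ m-measurable, so `K m`
    -- precedes the error `E m`, and the stopped noise sum has expectation at most N times E|ξ|.
    set K : ℕ → Set Ω := fun m =>
      {ω | ∑ i ∈ Finset.range (m + 1), ENNReal.ofReal (X i ω).2.1 ≤ N} with hK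
    have hKm : ∀ m, MeasurableSet[ℱ m] (K m) := by
      intro m
      have : Measurable[ℱ m] fun ω => ∑ i ∈ Finset.range (m + 1), ENNReal.ofReal (X i ω).2.1 := by
        refine Finset.measurable_fun_sum _ fun i hi => (hγm i).mono (ℱ.mono ?_) le_rfl
        simp only [Finset.mem_range] at hi; omega
      exact this measurableSet_Iic
    have hKm' : ∀ m, MeasurableSet (K m) := fun m => ℱ.le m _ (hKm m)
    set m₁ : ℝ≥0∞ := ∫⁻ e, ENNReal.ofReal |e| ∂ν with hm₁
    have hm₁top : m₁ ≠ ∞ := by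
      rw [hm₁, ← ofReal_integral_eq_lintegral_ofReal hi1.abs (ae_of_all _ fun e => abs_nonneg e)]
      exact ENNReal.ofReal_ne_top
    have hint : ∀ m, ∫⁻ ω in K m, ENNReal.ofReal (X m ω).2.1 * ENNReal.ofReal |E m ω| ∂μ =
        m₁ * ∫⁻ ω in K m, ENNReal.ofReal (X m ω).2.1 ∂μ := by
      intro m
      rw [h.setLIntegral_noise m (hKm m)
        (f := fun z => ENNReal.ofReal z.1.2.1 * ENNReal.ofReal |z.2|)
        (by fun_prop), ← lintegral_const_mul _ (hγm' m)]
      refine lintegral_congr fun ω => ?_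
      exact (lintegral_const_mul (ENNReal.ofReal (X m ω).2.1)
        (f := fun e => ENNReal.ofReal |e|) (by fun_prop)).trans (mul_comm _ _)
    have hbd : ∑' m, ∫⁻ ω in K m, ENNReal.ofReal (X m ω).2.1 ∂μ ≤ N := by
      rw [← lintegral_tsum_indicator hKm' hγm']
      calc _ ≤ ∫⁻ _, (N : ℝ≥0∞) ∂μ := by
            refine lintegral_mono fun ω => ENNReal.tsum_le_of_sum_range_le fun k => ?_
            induction k with
            | zero => simp
            | succ k ih =>
              by_cases hk : ω ∈ K k
              · refine le_trans (Finset.sum_le_sum fun i _ => ?_) hk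
                exact indicator_le_self _ _ _
              · rw [Finset.sum_range_succ, indicator_of_notMem hk, add_zero]
                exact ih
        _ = N := by simp
    have hfin : ∑' m, ∫⁻ ω in K m, ENNReal.ofReal (X m ω).2.1 * ENNReal.ofReal |E m ω| ∂μ ≠ ∞ := by
      rw [tsum_congr hint, ENNReal.tsum_mul_left]
      exact ENNReal.mul_ne_top hm₁top (ne_top_of_le_ne_top (ENNReal.natCast_ne_top N) hbd)
    filter_upwards [ae_tsum_ne_top hKm'
      (fun m => (hγm' m).mul (h.measurable_noise m).abs.ennreal_ofReal) hfin] with ω hω hN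
    exact hω fun m => (ENNReal.sum_le_tsum _).trans hN
  filter_upwards [ae_all_iff.2 key] with ω hω hsum
  obtain ⟨N, hN⟩ := ENNReal.exists_nat_gt hsum
  exact hω N hN.le

theorem ae_exists_tendsto_of_summableSteps (h : NoiseDriven μ ν (stepMap u d gbar φ) ℱ X E)
    (hγ : ∀ n ω, (X n ω).2.1 ∈ Ioc 0 gbar) {M : ℝ} (hM : 0 ≤ M)
    (hLip : ∀ a b, |φ a - φ b| ≤ M * |a - b|) (hi1 : Integrable (fun e => e) ν) :
    ∀ᵐ ω ∂μ, ω ∈ summableSteps X → ∃ p, Tendsto (fun n => (X n ω).1) atTop (𝓝 p) := by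
  filter_upwards [ae_tsum_noise_ne_top h hi1] with ω hω hsum
  have h1 : Summable fun n => (X n ω).2.1 := by
    have := ENNReal.summable_toReal hsum
    simpa only [ENNReal.toReal_ofReal (hγ _ ω).1.le] using this
  have h2 : Summable fun n => (X n ω).2.1 * |E n ω| := by
    have := ENNReal.summable_toReal (hω hsum)
    simpa only [ENNReal.toReal_mul, ENNReal.toReal_ofReal (hγ _ ω).1.le,
      ENNReal.toReal_ofReal (abs_nonneg _)] using this
  refine exists_tendsto_of_summable hM hLip (fun n => (hγ n ω).1.le) (fun n => ?_) h1 h2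
  simp only [h.succ, stepMap]

end Pathwise

/-! ### Mean contraction of γ^(-θ) in the supercritical case. -/

section Growth

variable {u d gbar : ℝ} {φ : ℝ → ℝ} {ν : Measure ℝ}

/-- c₃ is the largest of the three values, so replacing the probabilities of the half-lines by lower
bounds and giving the missing mass the value c₃ only increases the mean. -/
theorem lintegral_le_of_sign_bounds [IsProbabilityMeasure ν] {f : ℝ → ℝ≥0∞}
    {b α β c₁ c₂ c₃ : ℝ} (hc₁ : 0 ≤ c₁) (hc₂ : 0 ≤ c₂) (h13 : c₁ ≤ c₃) (h23 : c₂ ≤ c₃)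
    (hα : α ≤ ν.real (Ioi b)) (hβ : β ≤ ν.real (Iio b))
    (h1 : ∀ e, b < e → f e ≤ ENNReal.ofReal c₁) (h2 : ∀ e, e < b → f e ≤ ENNReal.ofReal c₂)
    (h3 : f b ≤ ENNReal.ofReal c₃) :
    ∫⁻ e, f e ∂ν ≤ ENNReal.ofReal (α * c₁ + β * c₂ + (1 - α - β) * c₃) := by
  have hc₃ : 0 ≤ c₃ := hc₁.trans h13
  have hle : ∀ e, f e ≤ (Ioi b).indicator (fun _ => ENNReal.ofReal c₁) e +
      ((Iio b).indicator (fun _ => ENNReal.ofReal c₂) e +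
        ({b} : Set ℝ).indicator (fun _ => ENNReal.ofReal c₃) e) := by
    intro e
    rcases lt_trichotomy e b with he | rfl | he
    · simpa [he, he.ne, he.le] using h2 e he
    · simpa using h3
    · simpa [he, he.ne', he.le] using h1 e he
  have hsum : ν.real (Ioi b) + ν.real (Iio b) + ν.real {b} = 1 := by
    have h4 := probReal_add_probReal_compl (μ := ν) (measurableSet_Ioi (a := b))
    rw [compl_Ioi, ← Iio_union_right, measureReal_union (by simp) (measurableSet_singleton b)] at h4
    linarith
  calc ∫⁻ e, f e ∂ν ≤ _ := lintegral_mono hle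
    _ = ENNReal.ofReal c₁ * ν (Ioi b) + (ENNReal.ofReal c₂ * ν (Iio b) +
          ENNReal.ofReal c₃ * ν {b}) := by
        rw [lintegral_add_left (measurable_const.indicator measurableSet_Ioi),
          lintegral_add_left (measurable_const.indicator measurableSet_Iio),
          lintegral_indicator_const measurableSet_Ioi, lintegral_indicator_const measurableSet_Iio,
          lintegral_indicator_const (measurableSet_singleton b)]
    _ = ENNReal.ofReal (c₁ * ν.real (Ioi b) + (c₂ * ν.real (Iio b) + c₃ * ν.real {b})) := by
        rw [ENNReal.ofReal_add (by positivity) (by positivity),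
          ENNReal.ofReal_add (by positivity) (by positivity), ENNReal.ofReal_mul hc₁,
          ENNReal.ofReal_mul hc₂, ENNReal.ofReal_mul hc₃, ofReal_measureReal, ofReal_measureReal,
          ofReal_measureReal]
    _ ≤ _ := by
        refine ENNReal.ofReal_le_ofReal ?_
        have h5 := mul_nonneg (sub_nonneg.2 hα) (sub_nonneg.2 h13)
        have h6 := mul_nonneg (sub_nonneg.2 hβ) (sub_nonneg.2 h23)
        have h7 : ν.real {b} = 1 - ν.real (Ioi b) - ν.real (Iio b) := by linarith
        rw [h7]
        linarith

/-- The weight of the sign of `y`. -/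
noncomputable def signWeight (a b c y : ℝ) : ℝ := if 0 < y then a else if y < 0 then b else c

theorem measurable_signWeight (a b c : ℝ) : Measurable (signWeight a b c) :=
  Measurable.ite measurableSet_Ioi measurable_const
    (Measurable.ite measurableSet_Iio measurable_const measurable_const)

theorem signWeight_of_pos {a b c y : ℝ} (h : 0 < y) : signWeight a b c y = a := if_pos h

theorem signWeight_of_neg {a b c y : ℝ} (h : y < 0) : signWeight a b c y = b := by
  rw [signWeight, if_neg h.not_gt, if_pos h]

theorem signWeight_zero {a b c : ℝ} : signWeight a b c 0 = c := by simp [signWeight]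

/-- A property of the three values of `signWeight`. -/
theorem signWeight_induction {p : ℝ → Prop} {a b c : ℝ} (ha : p a) (hb : p b) (hc : p c) (y : ℝ) :
    p (signWeight a b c y) := by
  unfold signWeight
  split_ifs <;> assumption

/-- Mean contraction of a negative power of the step size, when signs agree often enough, on the
event that `x` moves by less than `δ`. -/
theorem lintegral_growth_step_le [IsProbabilityMeasure ν] {θ a b c ρ α β κ δ lam r r' : ℝ}
    (hd0 : 0 < d) (hd1 : d < 1) (hu : 1 < u) (hθ : 0 < θ) (ha : 0 < a) (hb : 0 < b)
    (hac : a ≤ c) (hbc : b ≤ c) (hρ : 0 < ρ)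
    (h1 : α * (u ^ (-θ) * a) + β * (d ^ (-θ) * b) + (1 - α - β) * (d ^ (-θ) * c) ≤ ρ * a)
    (h2 : α * (d ^ (-θ) * a) + β * (u ^ (-θ) * b) + (1 - α - β) * (d ^ (-θ) * c) ≤ ρ * b)
    (h3 : α * (d ^ (-θ) * a) + β * (d ^ (-θ) * b) + (1 - α - β) * (d ^ (-θ) * c) ≤ ρ * c)
    (h4 : (1 - κ) * (d ^ (-θ) * c) ≤ ρ * a) (h5 : (1 - κ) * (d ^ (-θ) * c) ≤ ρ * b)
    (hα : α ≤ ν.real (Ioi (-r))) (hβ : β ≤ ν.real (Iio (-r')))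
    (hkill : ∀ z, ν {e | |z + e| < lam} ≤ ENNReal.ofReal (1 - κ)) (hδ : δ ≤ gbar / u * lam)
    {s : ℝ × ℝ × ℝ} (hs : s.2.1 ∈ Ioc 0 gbar) (hr : r ≤ φ s.1) (hr' : φ s.1 ≤ r') :
    ∫⁻ e, {e | |s.2.1 * (φ s.1 + e)| < δ}.indicator (fun e =>
        ENNReal.ofReal ((stepMap u d gbar φ s e).2.1 ^ (-θ) *
          signWeight a b c (stepMap u d gbar φ s e).2.2)) e ∂ν ≤
      ENNReal.ofReal ρ * ENNReal.ofReal (s.2.1 ^ (-θ) * signWeight a b c s.2.2) := by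
  obtain ⟨hs1, hs2⟩ := hs
  have hg : 0 < gbar := hs1.trans_le hs2
  set γ := s.2.1 with hγ
  have hc : 0 < c := ha.trans_le hac
  have hup : 0 < u ^ (-θ) := Real.rpow_pos_of_pos (by linarith) _
  have hdp : 0 < d ^ (-θ) := Real.rpow_pos_of_pos hd0 _
  have hγp : 0 < γ ^ (-θ) := Real.rpow_pos_of_pos hs1 _
  have hud : u ^ (-θ) ≤ d ^ (-θ) :=
    Real.rpow_le_rpow_of_nonpos hd0 (by linarith) (by linarith)
  have hdγ : (d * γ) ^ (-θ) = d ^ (-θ) * γ ^ (-θ) := Real.mul_rpow hd0.le hs1.le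
  have huγ : (u * γ) ^ (-θ) = u ^ (-θ) * γ ^ (-θ) := Real.mul_rpow (by linarith) hs1.le
  have hall : ∀ e, (stepMap u d gbar φ s e).2.1 ^ (-θ) ≤ d ^ (-θ) * γ ^ (-θ) := fun e => by
    rw [← hdγ]
    exact Real.rpow_le_rpow_of_nonpos (by positivity)
      (stepMap_γ_bounds hd0 hd1 hu ⟨hs1, hs2⟩ e).1 (by linarith)
  have hwc : ∀ y, signWeight a b c y ≤ c := signWeight_induction (p := (· ≤ c)) hac hbc le_rfl
  have hw0 : ∀ y, 0 < signWeight a b c y := signWeight_induction (p := (0 < ·)) ha hb hc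
  -- For γ ≥ ḡ/u the cap may prevent growth. There a displacement below δ forces |φ(x) + e| < lam,
  -- and the probability κ of the contrary compensates. Otherwise the cap is inactive and the signs
  -- decide.
  rcases le_or_gt (gbar / u) γ with hbig | hsmall
  · have hsub : {e | |γ * (φ s.1 + e)| < δ} ⊆ {e | |φ s.1 + e| < lam} := by
      intro e (he : |γ * (φ s.1 + e)| < δ)
      rw [abs_mul, abs_of_pos hs1] at he
      by_contra hcon
      have h6 : lam ≤ |φ s.1 + e| := not_lt.1 hcon
      have h7 : gbar / u * lam ≤ γ * |φ s.1 + e| :=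
        (mul_le_mul_of_nonneg_left h6 (by positivity)).trans
          (mul_le_mul_of_nonneg_right hbig (abs_nonneg _))
      linarith
    have hmeas : MeasurableSet {e | |γ * (φ s.1 + e)| < δ} :=
      measurableSet_lt (by fun_prop) measurable_const
    rw [lintegral_indicator hmeas]
    calc _ ≤ ∫⁻ _ in {e | |γ * (φ s.1 + e)| < δ},
          ENNReal.ofReal (γ ^ (-θ) * (d ^ (-θ) * c)) ∂ν := by
          refine lintegral_mono fun e => ENNReal.ofReal_le_ofReal ?_
          calc _ ≤ (d ^ (-θ) * γ ^ (-θ)) * c :=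
                mul_le_mul (hall e) (hwc _) (hw0 _).le (by positivity)
            _ = _ := by ring
      _ ≤ ENNReal.ofReal (γ ^ (-θ) * (d ^ (-θ) * c)) * ENNReal.ofReal (1 - κ) := by
          rw [setLIntegral_const]
          gcongr
          exact (measure_mono hsub).trans (hkill _)
      _ = ENNReal.ofReal (γ ^ (-θ) * ((1 - κ) * (d ^ (-θ) * c))) := by
          rw [← ENNReal.ofReal_mul (by positivity)]
          congr 1; ring
      _ ≤ ENNReal.ofReal (γ ^ (-θ) * (ρ * signWeight a b c s.2.2)) := by
          refine ENNReal.ofReal_le_ofReal (mul_le_mul_of_nonneg_left ?_ hγp.le)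
          exact signWeight_induction (p := fun w => (1 - κ) * (d ^ (-θ) * c) ≤ ρ * w) h4 h5
            (h4.trans (by gcongr)) _
      _ = _ := by
          rw [← ENNReal.ofReal_mul hρ.le]
          congr 1; ring
  · have hmin : min (u * γ) gbar = u * γ := by
      rw [lt_div_iff₀ (by linarith)] at hsmall
      exact min_eq_left (by linarith)
    have hα' : α ≤ ν.real (Ioi (-φ s.1)) :=
      hα.trans (measureReal_mono (Ioi_subset_Ioi (by linarith)))
    have hβ' : β ≤ ν.real (Iio (-φ s.1)) :=
      hβ.trans (measureReal_mono (Iio_subset_Iio (by linarith)))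
    have fin : ∀ k₁ k₂ w : ℝ, 0 ≤ k₁ → 0 ≤ k₂ → k₁ ≤ d ^ (-θ) * c → k₂ ≤ d ^ (-θ) * c →
        α * k₁ + β * k₂ + (1 - α - β) * (d ^ (-θ) * c) ≤ ρ * w →
        (∀ e, 0 < φ s.1 + e → (stepMap u d gbar φ s e).2.1 ^ (-θ) * a ≤ γ ^ (-θ) * k₁) →
        (∀ e, φ s.1 + e < 0 → (stepMap u d gbar φ s e).2.1 ^ (-θ) * b ≤ γ ^ (-θ) * k₂) →
        ∫⁻ e, {e | |γ * (φ s.1 + e)| < δ}.indicator (fun e =>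
          ENNReal.ofReal ((stepMap u d gbar φ s e).2.1 ^ (-θ) *
            signWeight a b c (stepMap u d gbar φ s e).2.2)) e ∂ν ≤
          ENNReal.ofReal ρ * ENNReal.ofReal (γ ^ (-θ) * w) := by
      intro k₁ k₂ w hk₁ hk₂ hk₁' hk₂' hle hpos hneg
      refine (lintegral_mono fun e => indicator_le_self _ _ e).trans ?_
      refine (lintegral_le_of_sign_bounds (b := -φ s.1) (c₁ := γ ^ (-θ) * k₁)
        (c₂ := γ ^ (-θ) * k₂) (c₃ := γ ^ (-θ) * (d ^ (-θ) * c)) (by positivity) (by positivity)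
        (by gcongr) (by gcongr) hα' hβ' ?_ ?_ ?_).trans ?_
      · intro e he
        have he' : 0 < φ s.1 + e := by linarith
        have : signWeight a b c (stepMap u d gbar φ s e).2.2 = a := signWeight_of_pos he'
        rw [this]
        exact ENNReal.ofReal_le_ofReal (hpos e he')
      · intro e he
        have he' : φ s.1 + e < 0 := by linarith
        have : signWeight a b c (stepMap u d gbar φ s e).2.2 = b := signWeight_of_neg he'
        rw [this]
        exact ENNReal.ofReal_le_ofReal (hneg e he')
      · refine ENNReal.ofReal_le_ofReal ?_
        calc _ ≤ (d ^ (-θ) * γ ^ (-θ)) * c :=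
              mul_le_mul (hall _) (hwc _) (hw0 _).le (by positivity)
          _ = _ := by ring
      · rw [← ENNReal.ofReal_mul hρ.le]
        refine ENNReal.ofReal_le_ofReal ?_
        have := mul_le_mul_of_nonneg_left hle hγp.le
        linarith
    have hany : ∀ e w, 0 < w → (stepMap u d gbar φ s e).2.1 ^ (-θ) * w ≤
        γ ^ (-θ) * (d ^ (-θ) * w) := fun e w hw => by
      have := mul_le_mul_of_nonneg_right (hall e) hw.le
      linarith
    have hagree : ∀ e w, 0 < s.2.2 * (φ s.1 + e) → (stepMap u d gbar φ s e).2.1 ^ (-θ) * w ≤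
        γ ^ (-θ) * (u ^ (-θ) * w) := fun e w he => by
      have : (stepMap u d gbar φ s e).2.1 = u * γ := (if_pos he).trans hmin
      rw [this, huγ]
      exact le_of_eq (by ring)
    rcases lt_trichotomy s.2.2 0 with hy | hy | hy
    · rw [signWeight_of_neg hy]
      exact fin (d ^ (-θ) * a) (u ^ (-θ) * b) b (by positivity) (by positivity) (by gcongr)
        (by gcongr) h2 (fun e _ => hany e a ha)
        fun e he => hagree e b (mul_pos_of_neg_of_neg hy he)
    · rw [hy, signWeight_zero]
      exact fin (d ^ (-θ) * a) (d ^ (-θ) * b) c (by positivity) (by positivity) (by gcongr)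
        (by gcongr) h3 (fun e _ => hany e a ha) fun e _ => hany e b hb
    · rw [signWeight_of_pos hy]
      exact fin (u ^ (-θ) * a) (d ^ (-θ) * b) a (by positivity) (by positivity) (by gcongr)
        (by gcongr) h1 (fun e he => hagree e a (mul_pos hy he)) fun e _ => hany e b hb

end Growth

/-! ### Supercritical points are not limits. -/

section Divergence

variable {Ω : Type*} {mΩ : MeasurableSpace Ω} {μ : Measure Ω}
  [IsProbabilityMeasure μ] {ν : Measure ℝ} {u d gbar : ℝ} {φ : ℝ → ℝ} {ℱ : Filtration ℕ mΩ}
  {X : ℕ → Ω → ℝ × ℝ × ℝ} {E : ℕ → Ω → ℝ}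

/-- If signs agree with probability above the critical ratio as long as `r ≤ φ x ≤ r'`, then
almost surely `φ x` leaves `[r, r']` or `x` makes steps of a fixed size, again and again. -/
theorem ae_not_forall_mem_Icc (h : NoiseDriven μ ν (stepMap u d gbar φ) ℱ X E)
    (hφm : Measurable φ) (hγ : ∀ n ω, (X n ω).2.1 ∈ Ioc 0 gbar)
    (hd0 : 0 < d) (hd1 : d < 1) (hu : 1 < u) (hg : 0 < gbar)
    {L : ℝ} (hL0 : 0 < L) (hL : ∀ a b, -L ≤ a → a < b → b ≤ L → 0 < ν (Ioo a b)) {r r' : ℝ}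
    (hk : critRatio u d < ν.real (Ioi (-r)) ^ 2 + ν.real (Iio (-r')) ^ 2) :
    ∀ᵐ ω ∂μ, ∀ T, ¬ ∀ n, T ≤ n → φ (X n ω).1 ∈ Icc r r' ∧
      |(X (n + 1) ω).1 - (X n ω).1| < gbar / u * (L / 2) := by
  have hprob := h.isProbabilityMeasure
  have hXm : ∀ n, Measurable (X n) := fun n => (h.adapted n).mono (ℱ.le n) le_rfl
  -- An error of size between L/2 and L with the sign of z makes |z + e| at least L/2.
  set κ : ℝ := min (ν.real (Ioo (L / 2) L)) (ν.real (Ioo (-L) (-(L / 2)))) with hκ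
  have hκ0 : 0 < κ := lt_min
    (ENNReal.toReal_pos (hL _ _ (by linarith) (by linarith) le_rfl).ne' (measure_ne_top _ _))
    (ENNReal.toReal_pos (hL _ _ le_rfl (by linarith) (by linarith)).ne' (measure_ne_top _ _))
  have hkill : ∀ z, ν {e | |z + e| < L / 2} ≤ ENNReal.ofReal (1 - κ) := by
    intro z
    have hcompl : ∀ I : Set ℝ, MeasurableSet I → κ ≤ ν.real I →
        (∀ e, |z + e| < L / 2 → e ∉ I) → ν {e | |z + e| < L / 2} ≤ ENNReal.ofReal (1 - κ) := by
      intro I hI hκI hsub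
      rw [← ofReal_measureReal]
      refine ENNReal.ofReal_le_ofReal ?_
      have h1 : ν.real {e | |z + e| < L / 2} ≤ ν.real Iᶜ := measureReal_mono hsub
      have h2 := probReal_add_probReal_compl (μ := ν) hI
      linarith
    rcases le_total 0 z with hz | hz
    · refine hcompl _ measurableSet_Ioo (min_le_left _ _) fun e he hI => ?_
      linarith [(abs_lt.1 he).2, hI.1]
    · refine hcompl _ measurableSet_Ioo (min_le_right _ _) fun e he hI => ?_
      linarith [(abs_lt.1 he).1, hI.2]
  obtain ⟨θ, a, b, c, ρ, hθ, ha, hb, hac, hbc, hρ0, hρ1, h1, h2, h3, h4, h5⟩ :=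
    exists_growth_weights hd0 hd1 hu (measureReal_nonneg (μ := ν) (s := Ioi (-r)))
      (measureReal_nonneg (μ := ν) (s := Iio (-r'))) hk hκ0
  set δ := gbar / u * (L / 2) with hδ
  set V : ℝ × ℝ × ℝ → ℝ≥0∞ := fun s =>
    ENNReal.ofReal (s.2.1 ^ (-θ) * signWeight a b c s.2.2) with hV
  have hVm : Measurable V := (((measurable_fst.comp measurable_snd).pow_const (-θ)).mul
    ((measurable_signWeight a b c).comp (measurable_snd.comp measurable_snd))).ennreal_ofReal
  set D : Set ((ℝ × ℝ × ℝ) × ℝ) := {z | |z.1.2.1 * (φ z.1.1 + z.2)| < δ} with hD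
  have hDm : MeasurableSet D := by
    refine measurableSet_lt (Measurable.abs (Measurable.mul (by fun_prop) ?_)) measurable_const
    exact (hφm.comp (measurable_fst.comp measurable_fst)).add measurable_snd
  -- A positive lower bound for the initial step makes γ^(-θ) integrable. The start at T + 1 gives
  -- the first displacement a predecessor.
  have key : ∀ T N : ℕ, ∀ᵐ ω ∂μ, (1 : ℝ) / (N + 1) ≤ (X (T + 1) ω).2.1 →
      ¬ ∀ n, T ≤ n → φ (X n ω).1 ∈ Icc r r' ∧ |(X (n + 1) ω).1 - (X n ω).1| < δ := by
    intro T N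
    set C : Set Ω := {ω | (1 : ℝ) / (N + 1) ≤ (X (T + 1) ω).2.1} with hC
    have hCm : MeasurableSet[ℱ (T + 1)] C :=
      (measurable_fst.comp (measurable_snd.comp (h.adapted (T + 1)))) measurableSet_Ici
    set P : ℕ → Set Ω := fun j =>
      {ω | φ (X j ω).1 ∈ Icc r r' ∧ |(X j ω).1 - (X (j - 1) ω).1| < δ} with hP
    have hPm : ∀ j, T + 1 ≤ j → MeasurableSet[ℱ j] (P j) := by
      intro j _
      have hj : Measurable[ℱ j] fun ω => (X j ω).1 := measurable_fst.comp (h.adapted j)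
      have hj' : Measurable[ℱ j] fun ω => (X (j - 1) ω).1 :=
        (measurable_fst.comp (h.adapted (j - 1))).mono (ℱ.mono (Nat.sub_le j 1)) le_rfl
      have hdiff : Measurable[ℱ j] fun ω => |(X j ω).1 - (X (j - 1) ω).1| :=
        (measurable_fst.sub measurable_snd).abs.comp (hj.prodMk hj')
      exact MeasurableSet.inter ((hφm.comp hj) measurableSet_Icc) (hdiff measurableSet_Iio)
    set K : ℕ → Set Ω := survival C P (T + 1) with hK
    have hKm : ∀ m, MeasurableSet[ℱ (T + 1 + m)] (K m) := measurableSet_survival hCm hPm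
    have hKm' : ∀ m, MeasurableSet (K m) := fun m => ℱ.le _ _ (hKm m)
    set v : ℕ → ℝ≥0∞ := fun m => ∫⁻ ω in K m, V (X (T + 1 + m) ω) ∂μ with hv
    have hstep : ∀ m, v (m + 1) ≤ ENNReal.ofReal ρ * v m := by
      intro m
      set f : (ℝ × ℝ × ℝ) × ℝ → ℝ≥0∞ := D.indicator fun z => V (stepMap u d gbar φ z.1 z.2)
      have hfm : Measurable f := (hVm.comp h.measurable_map).indicator hDm
      calc v (m + 1) ≤ ∫⁻ ω in K (m + 1), f (X (T + 1 + m) ω, E (T + 1 + m) ω) ∂μ := by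
            refine setLIntegral_mono' (hKm' _) fun ω hω => le_of_eq ?_
            have hmem := (hω.2 (m + 1) le_rfl).2
            rw [show T + 1 + (m + 1) - 1 = T + 1 + m by omega, ← add_assoc, h.succ] at hmem
            simp only [stepMap, sub_sub_cancel_left, abs_neg] at hmem
            have hmem' : (X (T + 1 + m) ω, E (T + 1 + m) ω) ∈ D := hmem
            have hf : f (X (T + 1 + m) ω, E (T + 1 + m) ω) =
                V (stepMap u d gbar φ (X (T + 1 + m) ω) (E (T + 1 + m) ω)) :=
              indicator_of_mem hmem' _
            rw [hf, ← add_assoc, h.succ]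
        _ ≤ ∫⁻ ω in K m, f (X (T + 1 + m) ω, E (T + 1 + m) ω) ∂μ :=
            lintegral_mono_set (survival_succ_subset _ _ _ _)
        _ ≤ ∫⁻ ω in K m, ENNReal.ofReal ρ * V (X (T + 1 + m) ω) ∂μ := by
            refine h.setLIntegral_noise_le (T + 1 + m) (hKm m) hfm
              (g := fun s => ENNReal.ofReal ρ * V s) fun ω hω => ?_
            have hIcc := (hω.2 m le_rfl).1
            exact lintegral_growth_step_le hd0 hd1 hu hθ ha hb hac hbc hρ0 h1 h2 h3 h4 h5
              le_rfl le_rfl hkill le_rfl (hγ _ _) hIcc.1 hIcc.2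
        _ = ENNReal.ofReal ρ * v m := lintegral_const_mul _ (hVm.comp (hXm _))
    have hpow : ∀ m, v m ≤ ENNReal.ofReal ρ ^ m * v 0 := by
      intro m
      induction m with
      | zero => simp
      | succ m ih =>
        refine (hstep m).trans ?_
        rw [pow_succ', mul_assoc]
        gcongr
    have hv0 : v 0 ≠ ∞ := by
      have : v 0 ≤ ∫⁻ _ in K 0, ENNReal.ofReal ((1 / (N + 1) : ℝ) ^ (-θ) * c) ∂μ := by
        refine setLIntegral_mono' (hKm' 0) fun ω hω => ENNReal.ofReal_le_ofReal ?_
        have hw : signWeight a b c (X (T + 1 + 0) ω).2.2 ≤ c :=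
          signWeight_induction (p := (· ≤ c)) hac hbc le_rfl _
        have hw0 : 0 ≤ signWeight a b c (X (T + 1 + 0) ω).2.2 :=
          signWeight_induction (p := (0 ≤ ·)) ha.le hb.le (ha.le.trans hac) _
        exact mul_le_mul (Real.rpow_le_rpow_of_nonpos (by positivity) hω.1 (by linarith)) hw hw0
          (by positivity)
      refine ne_top_of_le_ne_top ?_ this
      rw [setLIntegral_const]
      exact ENNReal.mul_ne_top ENNReal.ofReal_ne_top (measure_ne_top _ _)
    set w : ℝ≥0∞ := ENNReal.ofReal (gbar ^ (-θ) * min a b) with hw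
    have hw0 : w ≠ 0 := by
      have : 0 < gbar ^ (-θ) * min a b := mul_pos (Real.rpow_pos_of_pos hg _) (lt_min ha hb)
      simpa [hw] using this
    -- As γ ≤ ḡ, the contracting quantity is bounded below by `w`, so its decay forces the survival
    -- probability to zero.
    have hlow : ∀ m, w * μ (⋂ m, K m) ≤ v m := by
      intro m
      calc w * μ (⋂ m, K m) ≤ w * μ (K m) := by gcongr; exact iInter_subset _ _
        _ = ∫⁻ _ in K m, w ∂μ := (setLIntegral_const _ _).symm
        _ ≤ v m := by
            refine lintegral_mono fun ω => ENNReal.ofReal_le_ofReal ?_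
            obtain ⟨hγ1, hγ2⟩ := hγ (T + 1 + m) ω
            have hwt : min a b ≤ signWeight a b c (X (T + 1 + m) ω).2.2 :=
              signWeight_induction (p := (min a b ≤ ·)) (min_le_left _ _) (min_le_right _ _)
                ((min_le_left _ _).trans hac) _
            exact mul_le_mul (Real.rpow_le_rpow_of_nonpos hγ1 hγ2 (by linarith)) hwt
              (lt_min ha hb).le (Real.rpow_nonneg hγ1.le _)
    have hlim : Tendsto (fun m => ENNReal.ofReal ρ ^ m * v 0) atTop (𝓝 0) := by
      have := ENNReal.Tendsto.mul_const (b := v 0) (ENNReal.tendsto_pow_atTop_nhds_zero_of_lt_one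
        (r := ENNReal.ofReal ρ) (by simpa using hρ1)) (Or.inr hv0)
      simpa using this
    have hzero : w * μ (⋂ m, K m) ≤ 0 :=
      ge_of_tendsto' hlim fun m => (hlow m).trans (hpow m)
    have hzero' : μ (⋂ m, K m) = 0 := by
      rcases mul_eq_zero.1 (le_zero_iff.1 hzero) with h6 | h6
      · exact absurd h6 hw0
      · exact h6
    filter_upwards [measure_eq_zero_iff_ae_notMem.1 hzero'] with ω hω hωC hcon
    refine hω (mem_iInter.2 fun m => ⟨hωC, fun i _ => ⟨(hcon _ (by omega)).1, ?_⟩⟩)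
    have := (hcon (T + i) (by omega)).2
    rw [show T + 1 + i - 1 = T + i by omega, show T + 1 + i = T + i + 1 by omega]
    exact this
  filter_upwards [ae_all_iff.2 fun T => ae_all_iff.2 (key T)] with ω hω T
  obtain ⟨N, hN⟩ := exists_nat_one_div_lt (hγ (T + 1) ω).1
  exact hω T N hN.le

/-- Continuity from below of ν on open half-lines, whether or not -z is an atom. Rational bounds
reduce the uncountably many possible limits to countably many null events. -/
theorem exists_rat_lt_sign_bounds [IsFiniteMeasure ν] {k z : ℝ}
    (hk : k < ν.real (Ioi (-z)) ^ 2 + ν.real (Iio (-z)) ^ 2) :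
    ∃ r r' : ℚ, (r : ℝ) < z ∧ z < r' ∧
      k < ν.real (Ioi (-(r : ℝ))) ^ 2 + ν.real (Iio (-(r' : ℝ))) ^ 2 := by
  have hpos : ∀ n : ℕ, (0 : ℝ) < 1 / ((n : ℝ) + 1) := fun n => Nat.one_div_pos_of_nat
  have hanti : Antitone fun n : ℕ => 1 / ((n : ℝ) + 1) := fun m n hmn =>
    Nat.one_div_le_one_div hmn
  have h1 : Tendsto (fun n : ℕ => ν.real (Ioi (-z + 1 / ((n : ℝ) + 1)))) atTop
      (𝓝 (ν.real (Ioi (-z)))) := by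
    refine (ENNReal.tendsto_toReal (measure_ne_top _ _)).comp ?_
    have hU : (⋃ n : ℕ, Ioi (-z + 1 / ((n : ℝ) + 1))) = Ioi (-z) := by
      ext e
      simp only [mem_iUnion, mem_Ioi]
      refine ⟨fun ⟨n, hn⟩ => by linarith [hpos n], fun he => ?_⟩
      obtain ⟨n, hn⟩ := exists_nat_one_div_lt (show 0 < e + z by linarith)
      exact ⟨n, by linarith⟩
    rw [← hU]
    exact tendsto_measure_iUnion_atTop fun m n hmn => Ioi_subset_Ioi (by linarith [hanti hmn])
  have h2 : Tendsto (fun n : ℕ => ν.real (Iio (-z - 1 / ((n : ℝ) + 1)))) atTop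
      (𝓝 (ν.real (Iio (-z)))) := by
    refine (ENNReal.tendsto_toReal (measure_ne_top _ _)).comp ?_
    have hU : (⋃ n : ℕ, Iio (-z - 1 / ((n : ℝ) + 1))) = Iio (-z) := by
      ext e
      simp only [mem_iUnion, mem_Iio]
      refine ⟨fun ⟨n, hn⟩ => by linarith [hpos n], fun he => ?_⟩
      obtain ⟨n, hn⟩ := exists_nat_one_div_lt (show 0 < -z - e by linarith)
      exact ⟨n, by linarith⟩
    rw [← hU]
    exact tendsto_measure_iUnion_atTop fun m n hmn => Iio_subset_Iio (by linarith [hanti hmn])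
  obtain ⟨n, hn⟩ := (((h1.pow 2).add (h2.pow 2)).eventually_const_lt hk).exists
  obtain ⟨r, hr1, hr2⟩ := exists_rat_btwn (show z - 1 / ((n : ℝ) + 1) < z by linarith [hpos n])
  obtain ⟨r', hr1', hr2'⟩ := exists_rat_btwn (show z < z + 1 / ((n : ℝ) + 1) by linarith [hpos n])
  refine ⟨r, r', hr2, hr1', hn.trans_le ?_⟩
  have h3 : ν.real (Ioi (-z + 1 / ((n : ℝ) + 1))) ≤ ν.real (Ioi (-(r : ℝ))) :=
    measureReal_mono (Ioi_subset_Ioi (by linarith))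
  have h4 : ν.real (Iio (-z - 1 / ((n : ℝ) + 1))) ≤ ν.real (Iio (-(r' : ℝ))) :=
    measureReal_mono (Iio_subset_Iio (by linarith))
  gcongr

/-- Almost surely `x` converges to no point where signs agree with probability above the critical
ratio. -/
theorem ae_agree_le_critRatio_of_tendsto (h : NoiseDriven μ ν (stepMap u d gbar φ) ℱ X E)
    (hφ : Continuous φ) (hγ : ∀ n ω, (X n ω).2.1 ∈ Ioc 0 gbar)
    (hd0 : 0 < d) (hd1 : d < 1) (hu : 1 < u) (hg : 0 < gbar)
    {L : ℝ} (hL0 : 0 < L) (hL : ∀ a b, -L ≤ a → a < b → b ≤ L → 0 < ν (Ioo a b)) :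
    ∀ᵐ ω ∂μ, ∀ p, Tendsto (fun n => (X n ω).1) atTop (𝓝 p) →
      ν.real (Ioi (-φ p)) ^ 2 + ν.real (Iio (-φ p)) ^ 2 ≤ critRatio u d := by
  have hprob := h.isProbabilityMeasure
  have key : ∀ r r' : ℚ, ∀ᵐ ω ∂μ,
      critRatio u d < ν.real (Ioi (-(r : ℝ))) ^ 2 + ν.real (Iio (-(r' : ℝ))) ^ 2 →
        ∀ T, ¬ ∀ n, T ≤ n → φ (X n ω).1 ∈ Icc (r : ℝ) r' ∧
          |(X (n + 1) ω).1 - (X n ω).1| < gbar / u * (L / 2) := by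
    intro r r'
    by_cases hk : critRatio u d < ν.real (Ioi (-(r : ℝ))) ^ 2 + ν.real (Iio (-(r' : ℝ))) ^ 2
    · filter_upwards [ae_not_forall_mem_Icc h hφ.measurable hγ hd0 hd1 hu hg hL0 hL hk]
        with ω hω _ using hω
    · exact ae_of_all _ fun ω hk' => absurd hk' hk
  filter_upwards [ae_all_iff.2 fun r => ae_all_iff.2 (key r)] with ω hω p hp
  by_contra hcon
  obtain ⟨r, r', hr, hr', hk⟩ := exists_rat_lt_sign_bounds (not_le.1 hcon)
  have h1 : ∀ᶠ n in atTop, φ (X n ω).1 ∈ Icc (r : ℝ) r' :=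
    ((hφ.tendsto p).comp hp).eventually (Icc_mem_nhds hr hr')
  have h2 : Tendsto (fun n => |(X (n + 1) ω).1 - (X n ω).1|) atTop (𝓝 0) := by
    simpa using (((tendsto_add_atTop_iff_nat 1).2 hp).sub hp).abs
  have h3 := h2.eventually_lt_const (show 0 < gbar / u * (L / 2) by positivity)
  obtain ⟨T, hT⟩ := eventually_atTop.1 (h1.and h3)
  exact hω r r' hk T hT

end Divergence

/-! ### The agreement probability and its relation to k_- and k_+. -/

section Agreement

variable {Ω : Type*} [MeasurableSpace Ω] {μ : Measure Ω} [IsProbabilityMeasure μ]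
  {ξ x γ : ℕ → Ω → ℝ}

/-- Agreement means that both errors exceed -z or both are below it; `A1` at t = 1 makes the two
errors independent. -/
theorem measureReal_agree (hξ : ∀ t, Measurable (ξ t)) (hA1 : A1 μ ξ x γ) (hA2 : A2 μ ξ) (z : ℝ) :
    μ.real {ω | 0 < (z + ξ 1 ω) * (z + ξ 2 ω)} =
      (μ.map (ξ 1)).real (Ioi (-z)) ^ 2 + (μ.map (ξ 1)).real (Iio (-z)) ^ 2 := by
  have hind : IndepFun (ξ 2) (ξ 1) μ := by
    rw [IndepFun_iff_Indep]
    exact indep_of_indep_of_le_right (hA1 1)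
      (measurable_iff_comap_le.1 (measurable_history ξ x γ (le_refl 1)).2.2)
  have hprod : ∀ s : Set ℝ, MeasurableSet s →
      μ.real (ξ 2 ⁻¹' s ∩ ξ 1 ⁻¹' s) = (μ.map (ξ 1)).real s ^ 2 := by
    intro s hs
    have h1 := hind.measure_inter_preimage_eq_mul s s hs hs
    rw [measureReal_def, h1, ENNReal.toReal_mul, sq,
      map_measureReal_apply (hξ 1) hs, measureReal_def]
    congr 2
    rw [← Measure.map_apply (hξ 2) hs, (hA2.1 2 one_le_two).map_eq, Measure.map_apply (hξ 1) hs]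
  have hset : {ω | 0 < (z + ξ 1 ω) * (z + ξ 2 ω)} =
      (ξ 2 ⁻¹' Ioi (-z) ∩ ξ 1 ⁻¹' Ioi (-z)) ∪ (ξ 2 ⁻¹' Iio (-z) ∩ ξ 1 ⁻¹' Iio (-z)) := by
    ext ω
    simp only [mem_ofPred_eq, mem_union, mem_inter_iff, mem_preimage, mem_Ioi, mem_Iio, mul_pos_iff]
    constructor
    · rintro (⟨h1, h2⟩ | ⟨h1, h2⟩)
      · exact Or.inl ⟨by linarith, by linarith⟩
      · exact Or.inr ⟨by linarith, by linarith⟩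
    · rintro (⟨h1, h2⟩ | ⟨h1, h2⟩)
      · exact Or.inl ⟨by linarith, by linarith⟩
      · exact Or.inr ⟨by linarith, by linarith⟩
  rw [hset, measureReal_union _ (((hξ 2) measurableSet_Iio).inter ((hξ 1) measurableSet_Iio)),
    hprod _ measurableSet_Ioi, hprod _ measurableSet_Iio]
  refine Set.disjoint_left.2 fun ω h1 h2 => ?_
  exact lt_asymm (show -z < ξ 2 ω from h1.1) h2.1

/-- The diagonal pair a = b = z is the only one needed to compare `kMinus` and `kPlus` with the
agreement probability. -/
theorem measureReal_agree_mem (μ : Measure Ω) (ξ : ℕ → Ω → ℝ) (z : ℝ) {ε : ℝ} (hε : 0 < ε) :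
    μ.real {ω | 0 < (z + ξ 1 ω) * (z + ξ 2 ω)} ∈ agreeSet μ ξ z ε :=
  ⟨z, z, by simpa using hε, by simpa using hε, rfl⟩

theorem kMinus_le_measureReal_agree (ξ : ℕ → Ω → ℝ) (z : ℝ) :
    kMinus μ ξ z ≤ μ.real {ω | 0 < (z + ξ 1 ω) * (z + ξ 2 ω)} := by
  refine le_of_tendsto (tendsto_kMinus μ ξ z) ?_
  filter_upwards [self_mem_nhdsWithin] with ε hε
  exact csInf_le (bddBelow_Icc.mono (agreeSet_subset_Icc μ ξ z ε)) (measureReal_agree_mem μ ξ z hε)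

theorem measureReal_agree_le_kPlus (ξ : ℕ → Ω → ℝ) (z : ℝ) :
    μ.real {ω | 0 < (z + ξ 1 ω) * (z + ξ 2 ω)} ≤ kPlus μ ξ z := by
  refine ge_of_tendsto (tendsto_kPlus μ ξ z) ?_
  filter_upwards [self_mem_nhdsWithin] with ε hε
  exact le_csSup (bddAbove_Icc.mono (agreeSet_subset_Icc μ ξ z ε)) (measureReal_agree_mem μ ξ z hε)

/-- Supplies the lower bound without which the real infimum over z would not bound its members. -/
theorem kMinus_nonneg (ξ : ℕ → Ω → ℝ) (z : ℝ) : 0 ≤ kMinus μ ξ z := by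
  refine ge_of_tendsto (tendsto_kMinus μ ξ z) (Eventually.of_forall fun ε => ?_)
  exact Real.sInf_nonneg fun r hr => (agreeSet_subset_Icc μ ξ z ε hr).1

end Agreement

end StochApprox

/-! ### The main theorem. -/

theorem mainTheorem1 {Ω : Type*} [MeasurableSpace Ω] (μ : Measure Ω) [IsProbabilityMeasure μ]
    (u d gbar : ℝ) (hd0 : 0 < d) (hd1 : d < 1) (hu : 1 < u)
    (φ : ℝ → ℝ) (ξ x γ : ℕ → Ω → ℝ) (hξ : ∀ t, Measurable (ξ t))
    (hproc : StochApprox.IsProcess u d gbar φ ξ x γ)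
    (hA1 : StochApprox.A1 μ ξ x γ)
    (hA2 : StochApprox.A2 μ ξ)
    (hA3 : StochApprox.A3 μ ξ)
    (hA4 : StochApprox.A4 φ)
    (hA5 : StochApprox.A5 φ gbar)
    (hA6 : StochApprox.A6 μ ξ φ gbar) :
    (StochApprox.kPlus μ ξ 0 < StochApprox.critRatio u d →
      ∀ᵐ ω ∂μ, ∃ p ∈ StochApprox.VMinusClosed μ ξ φ (StochApprox.critRatio u d),
        Tendsto (fun t => x t ω) atTop (𝓝 p)) ∧
    (StochApprox.critRatio u d < ⨅ z : ℝ, StochApprox.kMinus μ ξ z →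
      ∀ᵐ ω ∂μ, ¬ ∃ p : ℝ, Tendsto (fun t => x t ω) atTop (𝓝 p)) := by
  open StochApprox in
  obtain ⟨⟨L, hL0, hL⟩, hatom⟩ := hA3
  obtain ⟨R, hR, hsign, hc₀⟩ := hA6
  have hφ : Continuous φ := hA4.1.continuous
  obtain ⟨ω₀⟩ : Nonempty Ω := nonempty_of_isProbabilityMeasure μ
  have hg : 0 < gbar := (hproc.γ_zero_mem ω₀).1.trans_le (hproc.γ_zero_mem ω₀).2
  set M := derivBound φ with hMdef
  have hM : 0 < M := derivBound_pos hA4 hR hsign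
  have hLip : ∀ a b, |φ a - φ b| ≤ M * |a - b| := hA4.abs_sub_le
  have hgM : gbar * M < 2 := (lt_div_iff₀ hM).1 hA5
  have hmeas := hproc.measurable_x hφ.measurable hξ
  have hle := history_le (fun t => (hmeas t).1) (fun t => (hmeas t).2) hξ
  have hN := hproc.noiseDriven hφ.measurable hξ hA1 hA2 hle
  set ν := μ.map (ξ 1) with hν
  have hprob := hN.isProbabilityMeasure
  have hγ : ∀ n ω, (state φ ξ x γ n ω).2.1 ∈ Ioc 0 gbar := fun n ω =>
    hproc.γ_mem hd0 hd1 hu (n + 1) ω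
  have hLI : ∀ a b, -L ≤ a → a < b → b ≤ L → 0 < ν (Ioo a b) := by
    intro a b ha hab hb
    rw [hν, Measure.map_apply (hξ 1) measurableSet_Ioo]
    exact hL _ ordConnected_Ioo ((Ioo_infinite hab).nontrivial)
      fun e he => ⟨ha.trans he.1.le, he.2.le.trans hb⟩
  -- Used by both parts: it places the limit in (a) and excludes every limit in (b).
  have hlimit : ∀ᵐ ω ∂μ, ∀ p, Tendsto (fun t => x t ω) atTop (𝓝 p) →
      kMinus μ ξ (φ p) ≤ critRatio u d := by
    filter_upwards [ae_agree_le_critRatio_of_tendsto hN hφ hγ hd0 hd1 hu hg hL0 hLI]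
      with ω hω p hp
    refine (kMinus_le_measureReal_agree ξ (φ p)).trans ?_
    rw [measureReal_agree hξ hA1 hA2]
    exact hω p ((tendsto_add_atTop_iff_nat 1).2 hp)
  constructor
  · intro hk
    obtain ⟨Φ, hΦd, hΦ0⟩ := exists_nonneg_primitive hφ hR hsign
    have hΦc : Continuous Φ := continuous_iff_continuousAt.2 fun t => (hΦd t).continuousAt
    have hid : AEStronglyMeasurable (fun e : ℝ => e) ν := measurable_id.aestronglyMeasurable
    have hid2 : AEStronglyMeasurable (fun e : ℝ => e ^ 2) ν := by fun_prop
    have hi1 : Integrable (fun e => e) ν :=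
      (integrable_map_measure hid (hξ 1).aemeasurable).2 (hA2.2.1.integrable one_le_two)
    have hi2 : Integrable (fun e => e ^ 2) ν :=
      (integrable_map_measure hid2 (hξ 1).aemeasurable).2 hA2.2.1.integrable_sq
    have hmean : ∫ e, e ∂ν = 0 := by
      rw [integral_map (hξ 1).aemeasurable hid]
      exact hA2.2.2
    have hvar : ∫ e, e ^ 2 ∂ν = variance (ξ 1) μ := by
      rw [integral_map (hξ 1).aemeasurable hid2,
        variance_of_integral_eq_zero (hξ 1).aemeasurable hA2.2.2]
    have hν0 : ν {0} = 0 := by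
      rw [hν, Measure.map_apply (hξ 1) (measurableSet_singleton 0)]
      exact hatom
    have hk' : ν.real (Ioi 0) ^ 2 + ν.real (Iio 0) ^ 2 < critRatio u d := by
      have h1 := measureReal_agree hξ hA1 hA2 0
      rw [neg_zero] at h1
      exact h1 ▸ (measureReal_agree_le_kPlus ξ 0).trans_lt hk
    have hRc : ∀ x, R ≤ |x| → sInf ((fun x => φ x ^ 2) '' {x | R ≤ |x|}) ≤ φ x ^ 2 := by
      intro x hx
      refine csInf_le ⟨0, ?_⟩ ⟨x, hx, rfl⟩
      rintro _ ⟨y, -, rfl⟩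
      exact sq_nonneg _
    filter_upwards [hlimit, ae_exists_tendsto_of_summableSteps hN hγ hM.le hLip hi1,
      ae_mem_summableSteps hN hφ hγ hd0 hd1 hu hg hM hLip hgM hΦc
        (descent_of_lipschitz hΦd hLip) hΦ0 hL0 hLI hν0 hi1 hi2 hmean hvar hRc hc₀ hk']
      with ω h1 h2 h3
    obtain ⟨p, hp⟩ := h2 h3
    have hp' : Tendsto (fun t => x t ω) atTop (𝓝 p) := (tendsto_add_atTop_iff_nat 1).1 hp
    exact ⟨p, h1 p hp', hp'⟩
  · intro hk
    filter_upwards [hlimit] with ω hω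
    rintro ⟨p, hp⟩
    refine absurd (hω p hp) (not_le.2 (hk.trans_le (ciInf_le ⟨0, ?_⟩ (φ p))))
    rintro _ ⟨z, rfl⟩
    exact kMinus_nonneg ξ z
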